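/- Let $U$ and $W$ be two disjoint sets of $n$ agents each. A preference profile $P$ assigns to every agent a strict linear order on a subset of the opposite set; the members of this subset are the agents acceptable to her. A matching of $P$ is a set of pairwise disjoint pairs $\{u,w\}$ with $u\in U$, $w\in W$ that are mutually acceptable. It is stable in $P$ if there is no pair $\{u,w\}\notin M$ of mutually acceptable agents such that each of the two is unmatched or prefers the other one to her partner in $M$; it is perfect if every agent is matched. The swap distance of two profiles is the sum, over all agents, of the number of pairs ordered differently in the agent's two lists (and $\infty$ if some agent's two lists rank different sets). The problem Globally Nearly Stable Perfect Matching asks, given $P$ and $d\in\mathbb N$, whether there are a profile $P'$ at swap distance at most $d$ from $P$ and a perfect matching that is stable in $P'$. Let $n_m$ be the number of agents of $U\cup W$ that are initially matched, i.e. contained in some stable matching of $P$. The computation model is a word RAM with unit-cost operations and words of $O(\log(N+d))$ bits, where $N$ is the input size, that is, the number of words of the input ($n$, $d$, and all preference lists). Then: 1. Globally Nearly Stable Perfect Matching can be solved in $O\bigl(n_m^{\,n_m^2\cdot\log n_m}\cdot n^2\bigr)$ time for $n\ge 1$ (with the convention that $n_m^{\,n_m^2\cdot\log n_m}=1$ for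 $n_m=0$), and in $O(1)$ time for $n=0$. 2. Globally Nearly Stable Perfect Matching, parameterized by $n_m$, admits a problem kernel with at most $\max(2n_m,2)$ agents (hence at most $2n_m$ agents whenever $n_m>0$) that can be computed in linear time: there are a computable function $g$ and an algorithm that, given $(P,d)$, computes in $O(N)$ time an instance $(P',d')$ that is a yes-instance if and only if $(P,d)$ is, that has at most $\max(2n_m,2)$ agents in total, and whose number of words plus $d'$ is at most $g(n_m)$. -/

import Mathlib

/-! ### Preference profiles, stable matchings, swap distance -/

/-- A preference profile for agent sets `U = {u_0, …, u_{n-1}}` and `W = {w_0, …, w_{n-1}}`.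
A linear order on a subset of the opposite side is given by the duplicate-free list of its
members, the most preferred agent first; the agents not in the list are unacceptable. -/
structure Profile (n : ℕ) where
  prefU : Fin n → List (Fin n)
  prefW : Fin n → List (Fin n)
  nodupU : ∀ u, (prefU u).Nodup
  nodupW : ∀ w, (prefW w).Nodup

namespace Profile

variable {n : ℕ}

/-- The rank of `w` in the list of `u`: the number of agents that `u` prefers to `w`, and the
number of all agents acceptable to `u` if `w` is unacceptable to `u`
(`List.idxOf` returns the length of the list for a non-member). -/
def rkU (P : Profile n) (u w : Fin n) : ℕ := (P.prefU u).idxOf w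

/-- The rank of `u` in the list of `w`. -/
def rkW (P : Profile n) (w u : Fin n) : ℕ := (P.prefW w).idxOf u

/-- `u` and `w` find each other acceptable. -/
def Acceptable (P : Profile n) (u w : Fin n) : Prop := w ∈ P.prefU u ∧ u ∈ P.prefW w

/-- A set of pairwise disjoint pairs `(u, w)` of agents who find each other acceptable. -/
def IsMatching (P : Profile n) (M : Finset (Fin n × Fin n)) : Prop :=
  (∀ p ∈ M, P.Acceptable p.1 p.2) ∧
  (∀ p ∈ M, ∀ q ∈ M, p ≠ q → p.1 ≠ q.1 ∧ p.2 ≠ q.2)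

/-- The pair `{u, w}` blocks `M`. The last two clauses say that the agent is unmatched or
ranks the other one higher than the partner. -/
def Blocks (P : Profile n) (M : Finset (Fin n × Fin n)) (u w : Fin n) : Prop :=
  P.Acceptable u w ∧ (u, w) ∉ M ∧
  (∀ w', (u, w') ∈ M → P.rkU u w < P.rkU u w') ∧
  (∀ u', (u', w) ∈ M → P.rkW w u < P.rkW w u')

def IsStable (P : Profile n) (M : Finset (Fin n × Fin n)) : Prop :=
  P.IsMatching M ∧ ∀ u w, ¬ P.Blocks M u w

/-- The number of pairs `{x, y}` that the two lists order differently (each such pair is counted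
once, as the ordered pair whose first component comes first in `l`); infinite if the lists
rank different sets of agents. -/
def listSwapDist (l l' : List (Fin n)) : ℕ∞ :=
  if l.toFinset = l'.toFinset then
    (((l.toFinset ×ˢ l.toFinset).filter fun p =>
      l.idxOf p.1 < l.idxOf p.2 ∧ l'.idxOf p.2 < l'.idxOf p.1).card : ℕ∞)
  else ⊤

/-- The swap distance of two profiles: the sum of the swap distances over all agents. -/
def swapDist (P Q : Profile n) : ℕ∞ :=
  (∑ u, listSwapDist (P.prefU u) (Q.prefU u)) + ∑ w, listSwapDist (P.prefW w) (Q.prefW w)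

/-- `M` is globally `d`-nearly stable for `P`. -/
def GloballyNearlyStable (P : Profile n) (d : ℕ) (M : Finset (Fin n × Fin n)) : Prop :=
  ∃ Q : Profile n, P.swapDist Q ≤ d ∧ Q.IsStable M

/-- The agent `x` (`Sum.inl u` is `u ∈ U`, `Sum.inr w` is `w ∈ W`) has a partner in `M`. -/
def IsMatchedBy (M : Finset (Fin n × Fin n)) (x : Fin n ⊕ Fin n) : Prop :=
  match x with
  | Sum.inl u => ∃ w, (u, w) ∈ M
  | Sum.inr w => ∃ u, (u, w) ∈ M

def IsPerfect (M : Finset (Fin n × Fin n)) : Prop := ∀ x : Fin n ⊕ Fin n, IsMatchedBy M x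

/-- An agent is initially unmatched if no stable matching of `P` contains it, and initially
matched otherwise. -/
def InitiallyMatched (P : Profile n) (x : Fin n ⊕ Fin n) : Prop :=
  ∃ M, P.IsStable M ∧ IsMatchedBy M x

/-- The number of initially matched agents (of both sides together). -/
noncomputable def numMatched (P : Profile n) : ℕ := Nat.card {x // P.InitiallyMatched x}

end Profile

/-! ### The decision problem -/

/-- An instance of Globally Nearly Stable Perfect Matching. -/
structure GNSPM where
  n : ℕ
  profile : Profile n
  d : ℕ

namespace GNSPM

/-- There is a perfect matching that is globally `d`-nearly stable. -/
def IsYes (I : GNSPM) : Prop :=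
  ∃ M, I.profile.GloballyNearlyStable I.d M ∧ Profile.IsPerfect M

/-- The parameter: the number of initially matched agents. -/
noncomputable def nm (I : GNSPM) : ℕ := I.profile.numMatched

/-- A preference list as a sequence of words: its length, then its members in order. -/
def encodeList {n : ℕ} (l : List (Fin n)) : List ℕ := l.length :: l.map Fin.val

/-- An instance as a sequence of words: `n`, `d`, the preference lists of `u_0, u_1, …`, and
those of `w_0, w_1, …`. -/
def encode (I : GNSPM) : List ℕ :=
  I.n :: I.d ::
    ((List.finRange I.n).flatMap (fun u => encodeList (I.profile.prefU u)) ++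
     (List.finRange I.n).flatMap (fun w => encodeList (I.profile.prefW w)))

/-- The input size: the number of words of the input. -/
def size (I : GNSPM) : ℕ := I.encode.length

/-- The largest word available on input `I`: `(size + d) ^ k`, so that words have
`O(log (size + d))` bits. -/
def maxWord (I : GNSPM) (k : ℕ) : ℕ := (I.size + I.d) ^ k

end GNSPM

/-! ### The machine model: a word RAM

Programs are while-programs over a random access memory and finitely many registers. Every
elementary operation costs one step. All numbers (values and addresses) that occur have to be at
most the largest word `B`: a computation that exceeds `B` is stuck, and does not count as halting.
-/

namespace WordRAM

structure State where
  reg : ℕ → ℕ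
  mem : ℕ → ℕ

inductive Expr where
  | lit (c : ℕ)
  | reg (x : ℕ)
  | mem (a : Expr)
  | add (a b : Expr)
  | sub (a b : Expr)
  | mul (a b : Expr)
  | lt (a b : Expr)
  | eq (a b : Expr)

namespace Expr

/-- Subtraction is truncated; comparisons return `1` or `0`. -/
def eval (s : State) : Expr → ℕ
  | lit c => c
  | reg x => s.reg x
  | mem a => s.mem (a.eval s)
  | add a b => a.eval s + b.eval s
  | sub a b => a.eval s - b.eval s
  | mul a b => a.eval s * b.eval s
  | lt a b => if a.eval s < b.eval s then 1 else 0
  | eq a b => if a.eval s = b.eval s then 1 else 0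

/-- The number of steps of evaluating an expression: its number of nodes. -/
def cost : Expr → ℕ
  | lit _ => 1
  | reg _ => 1
  | mem a => a.cost + 1
  | add a b => a.cost + b.cost + 1
  | sub a b => a.cost + b.cost + 1
  | mul a b => a.cost + b.cost + 1
  | lt a b => a.cost + b.cost + 1
  | eq a b => a.cost + b.cost + 1

/-- Every value computed in the evaluation (of the expression and all its parts) is at
most `B`. -/
def Fits (B : ℕ) (s : State) : Expr → Prop
  | lit c => c ≤ B
  | reg x => s.reg x ≤ B
  | mem a => a.Fits B s ∧ s.mem (a.eval s) ≤ B
  | add a b => a.Fits B s ∧ b.Fits B s ∧ a.eval s + b.eval s ≤ B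
  | sub a b => a.Fits B s ∧ b.Fits B s
  | mul a b => a.Fits B s ∧ b.Fits B s ∧ a.eval s * b.eval s ≤ B
  | lt a b => a.Fits B s ∧ b.Fits B s ∧ 1 ≤ B
  | eq a b => a.Fits B s ∧ b.Fits B s ∧ 1 ≤ B

end Expr

inductive Cmd where
  | skip
  /-- register `x` := `e` -/
  | assign (x : ℕ) (e : Expr)
  /-- memory cell with address `a` := `e` -/
  | store (a e : Expr)
  | seq (c₁ c₂ : Cmd)
  /-- run `c₁` if the value of `e` is not `0`, and `c₂` otherwise -/
  | ite (e : Expr) (c₁ c₂ : Cmd)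
  /-- repeat `c` as long as the value of `e` is not `0` -/
  | loop (e : Expr) (c : Cmd)

/-- `Exec B c s t s'`: with largest word `B`, the program `c` started in state `s` halts after
exactly `t` steps in state `s'`. -/
inductive Exec (B : ℕ) : Cmd → State → ℕ → State → Prop
  | skip (s : State) : Exec B Cmd.skip s 1 s
  | assign (s : State) (x : ℕ) (e : Expr) (he : e.Fits B s) :
      Exec B (Cmd.assign x e) s (e.cost + 1)
        { s with reg := Function.update s.reg x (e.eval s) }
  | store (s : State) (a e : Expr) (ha : a.Fits B s) (he : e.Fits B s) :
      Exec B (Cmd.store a e) s (a.cost + e.cost + 1)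
        { s with mem := Function.update s.mem (a.eval s) (e.eval s) }
  | seq {s s₁ s₂ : State} {c₁ c₂ : Cmd} {t₁ t₂ : ℕ}
      (h₁ : Exec B c₁ s t₁ s₁) (h₂ : Exec B c₂ s₁ t₂ s₂) :
      Exec B (Cmd.seq c₁ c₂) s (t₁ + t₂) s₂
  | ite_true {s s' : State} {e : Expr} {c₁ c₂ : Cmd} {t : ℕ}
      (he : e.Fits B s) (hv : e.eval s ≠ 0) (h : Exec B c₁ s t s') :
      Exec B (Cmd.ite e c₁ c₂) s (e.cost + 1 + t) s'
  | ite_false {s s' : State} {e : Expr} {c₁ c₂ : Cmd} {t : ℕ}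
      (he : e.Fits B s) (hv : e.eval s = 0) (h : Exec B c₂ s t s') :
      Exec B (Cmd.ite e c₁ c₂) s (e.cost + 1 + t) s'
  | loop_true {s s₁ s₂ : State} {e : Expr} {c : Cmd} {t₁ t₂ : ℕ}
      (he : e.Fits B s) (hv : e.eval s ≠ 0)
      (h₁ : Exec B c s t₁ s₁) (h₂ : Exec B (Cmd.loop e c) s₁ t₂ s₂) :
      Exec B (Cmd.loop e c) s (e.cost + 1 + t₁ + t₂) s₂
  | loop_false {s : State} {e : Expr} {c : Cmd} (he : e.Fits B s) (hv : e.eval s = 0) :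
      Exec B (Cmd.loop e c) s (e.cost + 1) s

/-- The initial state: the input stands in the memory cells `0, 1, …`; all other cells and all
registers are `0`. -/
def State.init (xs : List ℕ) : State where
  reg := fun _ => 0
  mem := fun i => xs.getD i 0

/-- The output `ys` stands in consecutive memory cells, the first of which has its address in
register `0`. -/
def State.Outputs (s : State) (ys : List ℕ) : Prop :=
  ∀ i (hi : i < ys.length), s.mem (s.reg 0 + i) = ys[i]

/-- The answer of a decision algorithm stands in register `0`: `1` for yes, `0` for no. -/
def State.Answers (s : State) (p : Prop) : Prop :=
  (p → s.reg 0 = 1) ∧ (¬ p → s.reg 0 = 0)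

end WordRAM

/-!
Deferred acceptance finds a stable matching `M` of the given profile, and the `2 * |M|` agents in
`M` are initially matched. Swaps do not change which pairs are mutually acceptable, and each such
pair contains an agent in `M` because it does not block `M`. The `n` disjoint pairs of a perfect
matching that is stable after some swaps therefore force `n ≤ 2 * |M| ≤ nm`. So the answer is no if
`2 * |M| < n`, and otherwise `n ≤ nm`. In the latter case the instance itself is a kernel once `d`
is capped at `2 * n ^ 3`, a bound for all finite swap distances, and exhaustive search is fast
enough: a new profile and a perfect matching are given by a table with one rank for every ordered
pair of agents of opposite sides and one partner for every agent, and there are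
`n ^ (2 * n * (n + 1))` such tables, which is at most `n ^ (n ^ 2 * log n)` for large `n`.
-/

namespace WordRAM

/-! ### Bounded executions -/

/-- All registers and memory cells hold numbers at most `b`. -/
def State.Bdd (b : ℕ) (s : State) : Prop := (∀ x, s.reg x ≤ b) ∧ ∀ a, s.mem a ≤ b

namespace Expr

/-- An exponent `m` such that, in a state with numbers at most `b`, where `2 ≤ b`, no value computed
in the evaluation of the expression exceeds `b ^ m`. -/
def width : Expr → ℕ
  | lit c => c
  | reg _ => 1
  | mem a => a.width + 1
  | add a b => a.width + b.width + 1
  | sub a b => a.width + b.width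
  | mul a b => a.width + b.width
  | lt a b => a.width + b.width
  | eq a b => a.width + b.width

variable {b : ℕ} {s : State}

theorem eval_le_pow_width (hb : 2 ≤ b) (hs : s.Bdd b) (e : Expr) : e.eval s ≤ b ^ e.width := by
  have one_le (m : ℕ) : 1 ≤ b ^ m := Nat.one_le_pow _ _ (by omega)
  have mono {i j : ℕ} (h : i ≤ j) : b ^ i ≤ b ^ j := Nat.pow_le_pow_right (by omega) h
  induction e with
  | lit c => exact Nat.lt_two_pow_self.le.trans (Nat.pow_le_pow_left hb c)
  | reg x => simpa [eval, width] using hs.1 x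
  | mem a => exact (hs.2 _).trans (Nat.le_self_pow (by simp [width]) b)
  | add e f ihe ihf =>
    calc e.eval s + f.eval s
        ≤ b ^ (e.width + f.width) + b ^ (e.width + f.width) := by
          gcongr
          · exact ihe.trans (mono (by omega))
          · exact ihf.trans (mono (by omega))
      _ ≤ b ^ (e.width + f.width) * b := by rw [← mul_two]; gcongr
      _ = b ^ (add e f).width := (pow_succ ..).symm
  | sub e f ihe => exact (Nat.sub_le _ _).trans (ihe.trans (mono (by simp [width])))
  | mul e f ihe ihf => exact (Nat.mul_le_mul ihe ihf).trans_eq (pow_add ..).symm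
  | lt e f => rw [eval]; split_ifs <;> simp [one_le]
  | eq e f => rw [eval]; split_ifs <;> simp [one_le]

theorem fits_pow (hb : 2 ≤ b) (hs : s.Bdd b) {e : Expr} {m : ℕ} (hm : e.width ≤ m) :
    e.Fits (b ^ m) s := by
  have eval_le {e : Expr} (h : e.width ≤ m) : e.eval s ≤ b ^ m :=
    (eval_le_pow_width hb hs e).trans (Nat.pow_le_pow_right (by omega) h)
  have one_le : 1 ≤ b ^ m := Nat.one_le_pow _ _ (by omega)
  induction e with
  | lit c => exact eval_le (e := lit c) hm
  | reg x => exact eval_le (e := reg x) hm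
  | mem a iha => exact ⟨iha ((Nat.le_succ _).trans hm), eval_le (e := mem a) hm⟩
  | add e f ihe ihf =>
    have : e.width + f.width + 1 ≤ m := hm
    exact ⟨ihe (by omega), ihf (by omega), eval_le (e := add e f) hm⟩
  | sub e f ihe ihf =>
    have : e.width + f.width ≤ m := hm
    exact ⟨ihe (by omega), ihf (by omega)⟩
  | mul e f ihe ihf =>
    have : e.width + f.width ≤ m := hm
    exact ⟨ihe (by omega), ihf (by omega), eval_le (e := mul e f) hm⟩
  | lt e f ihe ihf | eq e f ihe ihf =>
    have : e.width + f.width ≤ m := hm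
    exact ⟨ihe (by omega), ihf (by omega), one_le⟩

end Expr

namespace Cmd

/-- An exponent `m` such that words up to `b ^ m` suffice for the program as long as all numbers
that it writes are at most `b`, where `2 ≤ b`. -/
def width : Cmd → ℕ
  | skip => 0
  | assign _ e => e.width
  | store a e => a.width + e.width
  | seq c₁ c₂ => c₁.width + c₂.width
  | ite e c₁ c₂ => e.width + c₁.width + c₂.width
  | loop e c => e.width + c.width

/-- The time for executing every instruction of the program once. It bounds the time of a
loop-free program. -/
def cost : Cmd → ℕ
  | skip => 1
  | assign _ e => e.cost + 1
  | store a e => a.cost + e.cost + 1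
  | seq c₁ c₂ => c₁.cost + c₂.cost
  | ite e c₁ c₂ => e.cost + 1 + c₁.cost + c₂.cost
  | loop e c => e.cost + 1 + c.cost

end Cmd

/-- Started in `s`, the program `c` halts within `T` steps in a state satisfying `Q`, and all
numbers that it writes are at most `b`, provided that all numbers in `s` are. -/
def Runs (b : ℕ) (c : Cmd) (s : State) (T : ℕ) (Q : State → Prop) : Prop :=
  2 ≤ b → s.Bdd b →
    ∃ t ≤ T, ∃ s', (∀ m, c.width ≤ m → Exec (b ^ m) c s t s') ∧ s'.Bdd b ∧ Q s'

namespace Runs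

variable {b : ℕ} {s : State} {T : ℕ} {Q : State → Prop}

theorem mono {c : Cmd} {T' : ℕ} {Q' : State → Prop} (h : Runs b c s T Q) (hT : T ≤ T')
    (hQ : ∀ s', Q s' → Q' s') : Runs b c s T' Q' := by
  intro hb hs
  obtain ⟨t, ht, s', hexec, hs', q⟩ := h hb hs
  exact ⟨t, ht.trans hT, s', hexec, hs', hQ s' q⟩

theorem skip (h : Q s) : Runs b .skip s 1 Q :=
  fun _ hs => ⟨1, le_rfl, s, fun _ _ => .skip s, hs, h⟩

theorem assign {x : ℕ} {e : Expr} (he : e.eval s ≤ b)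
    (h : Q { s with reg := Function.update s.reg x (e.eval s) }) :
    Runs b (.assign x e) s (e.cost + 1) Q := by
  intro hb hs
  refine ⟨_, le_rfl, _, fun m hm => .assign s x e (e.fits_pow hb hs hm), ⟨fun y => ?_, hs.2⟩, h⟩
  change Function.update s.reg x (e.eval s) y ≤ b
  rw [Function.update_apply]
  split_ifs
  exacts [he, hs.1 y]

theorem store {a e : Expr} (he : e.eval s ≤ b)
    (h : Q { s with mem := Function.update s.mem (a.eval s) (e.eval s) }) :
    Runs b (.store a e) s (a.cost + e.cost + 1) Q := by
  intro hb hs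
  have fits {m : ℕ} (hm : (Cmd.store a e).width ≤ m) : a.Fits (b ^ m) s ∧ e.Fits (b ^ m) s :=
    ⟨a.fits_pow hb hs ((Nat.le_add_right ..).trans hm),
      e.fits_pow hb hs ((Nat.le_add_left ..).trans hm)⟩
  refine ⟨_, le_rfl, _, fun m hm => .store s a e (fits hm).1 (fits hm).2,
    ⟨hs.1, fun y => ?_⟩, h⟩
  change Function.update s.mem (a.eval s) (e.eval s) y ≤ b
  rw [Function.update_apply]
  split_ifs
  exacts [he, hs.2 y]

theorem seq {c₁ c₂ : Cmd} {T₁ T₂ : ℕ} {Q₁ : State → Prop} (h₁ : Runs b c₁ s T₁ Q₁)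
    (h₂ : ∀ s', Q₁ s' → Runs b c₂ s' T₂ Q) : Runs b (.seq c₁ c₂) s (T₁ + T₂) Q := by
  intro hb hs
  obtain ⟨t₁, ht₁, s₁, hexec₁, hs₁, q₁⟩ := h₁ hb hs
  obtain ⟨t₂, ht₂, s₂, hexec₂, hs₂, q₂⟩ := h₂ s₁ q₁ hb hs₁
  refine ⟨t₁ + t₂, by omega, s₂, fun m hm => ?_, hs₂, q₂⟩
  rw [Cmd.width] at hm
  exact .seq (hexec₁ m (by omega)) (hexec₂ m (by omega))

theorem ite {e : Expr} {c₁ c₂ : Cmd} {T₁ T₂ : ℕ} (h₁ : e.eval s ≠ 0 → Runs b c₁ s T₁ Q)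
    (h₂ : e.eval s = 0 → Runs b c₂ s T₂ Q) :
    Runs b (.ite e c₁ c₂) s (e.cost + 1 + T₁ + T₂) Q := by
  intro hb hs
  by_cases he : e.eval s = 0
  · obtain ⟨t, ht, s', hexec, hs', q⟩ := h₂ he hb hs
    refine ⟨e.cost + 1 + t, by omega, s', fun m hm => ?_, hs', q⟩
    rw [Cmd.width] at hm
    exact .ite_false (e.fits_pow hb hs (by omega)) he (hexec m (by omega))
  · obtain ⟨t, ht, s', hexec, hs', q⟩ := h₁ he hb hs
    refine ⟨e.cost + 1 + t, by omega, s', fun m hm => ?_, hs', q⟩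
    rw [Cmd.width] at hm
    exact .ite_true (e.fits_pow hb hs (by omega)) he (hexec m (by omega))

theorem loop_of_variant {e : Expr} {c : Cmd} (Inv : ℕ → State → Prop)
    (body : ∀ j s, Inv j s → e.eval s ≠ 0 → Runs b c s T fun s' => ∃ j' < j, Inv j' s')
    {j : ℕ} (hs : Inv j s) :
    Runs b (.loop e c) s ((e.cost + 1 + T) * (j + 1)) fun s' =>
      (∃ j', Inv j' s') ∧ e.eval s' = 0 := by
  intro hb
  induction j using Nat.strong_induction_on generalizing s with
  | h j ih =>
    intro hbdd
    have guard_fits {m : ℕ} (hm : (Cmd.loop e c).width ≤ m) : e.Fits (b ^ m) s :=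
      e.fits_pow hb hbdd ((Nat.le_add_right ..).trans hm)
    by_cases he : e.eval s = 0
    · exact ⟨e.cost + 1, by nlinarith, s, fun m hm => .loop_false (guard_fits hm) he, hbdd,
        ⟨j, hs⟩, he⟩
    · obtain ⟨t₁, ht₁, s₁, hexec₁, hbdd₁, j₁, hlt, hs₁⟩ := body j s hs he hb hbdd
      obtain ⟨t₂, ht₂, s₂, hexec₂, hbdd₂, hs₂⟩ := ih j₁ hlt hs₁ hbdd₁
      refine ⟨e.cost + 1 + t₁ + t₂, ?_, s₂, fun m hm => .loop_true (guard_fits hm) he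
        (hexec₁ m ((Nat.le_add_left ..).trans hm)) (hexec₂ m hm), hbdd₂, hs₂⟩
      calc e.cost + 1 + t₁ + t₂
          ≤ (e.cost + 1 + T) + (e.cost + 1 + T) * (j₁ + 1) := by omega
        _ = (e.cost + 1 + T) * (j₁ + 1 + 1) := by ring
        _ ≤ (e.cost + 1 + T) * (j + 1) := by gcongr; omega

theorem loop {e : Expr} {c : Cmd} (Inv : State → Prop) (φ : State → ℕ)
    (body : ∀ s, Inv s → e.eval s ≠ 0 → Runs b c s T fun s' => Inv s' ∧ φ s' < φ s)
    (hs : Inv s) :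
    Runs b (.loop e c) s ((e.cost + 1 + T) * (φ s + 1)) fun s' => Inv s' ∧ e.eval s' = 0 := by
  refine (loop_of_variant (fun j s => Inv s ∧ φ s = j) ?_ ⟨hs, rfl⟩).mono le_rfl ?_
  · rintro _ s ⟨hs, rfl⟩ he
    exact (body s hs he).mono le_rfl fun s' h => ⟨φ s', h.2, h.1, rfl⟩
  · rintro s' ⟨⟨_, hs', -⟩, he⟩
    exact ⟨hs', he⟩

end Runs

/-- The weakest precondition of a loop-free program for the postcondition `Q`, under the
requirement that all numbers written are at most `b`. -/
def Cmd.wp (b : ℕ) : Cmd → (State → Prop) → State → Prop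
  | skip, Q, s => Q s
  | assign x e, Q, s => e.eval s ≤ b ∧ Q { s with reg := Function.update s.reg x (e.eval s) }
  | store a e, Q, s =>
    e.eval s ≤ b ∧ Q { s with mem := Function.update s.mem (a.eval s) (e.eval s) }
  | seq c₁ c₂, Q, s => c₁.wp b (c₂.wp b Q) s
  | ite e c₁ c₂, Q, s => (e.eval s ≠ 0 → c₁.wp b Q s) ∧ (e.eval s = 0 → c₂.wp b Q s)
  | loop _ _, _, _ => False

theorem Runs.of_wp {b : ℕ} {c : Cmd} {s : State} {Q : State → Prop} (h : c.wp b Q s) :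
    Runs b c s c.cost Q := by
  induction c generalizing s Q with
  | skip => exact .skip h
  | assign x e => exact .assign h.1 h.2
  | store a e => exact .store h.1 h.2
  | seq c₁ c₂ ih₁ ih₂ => exact .seq (ih₁ h) fun _ => ih₂
  | ite e c₁ c₂ ih₁ ih₂ => exact .ite (fun he => ih₁ (h.1 he)) fun he => ih₂ (h.2 he)
  | loop e c => exact h.elim

theorem Runs.of_wp_seq {b : ℕ} {c₁ c₂ : Cmd} {s : State} {T : ℕ} {Q : State → Prop}
    (h : c₁.wp b (Runs b c₂ · T Q) s) : Runs b (.seq c₁ c₂) s (c₁.cost + T) Q :=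
  .seq (.of_wp h) fun _ => id

/-! ### Programs with named variables and arrays -/

/-- The registers used by the programs, under a name; the address of a register is the position of
its name in this list. -/
inductive Var where
  | answer
  | n
  | rowLength
  | base
  | agent
  | pointer
  | column
  | started
  | proposer
  | engaged
  | candidate
  | rival
  | owner
  | first
  | second
  | total
  | place
  | exhausted
  deriving DecidableEq

/-- The arrays used by the programs. They are interleaved in the memory above the address in the
register `base`, so that their lengths need not be bounded. -/
inductive Table where
  | rank
  | entry
  | proposals
  | fiance
  | certificate
  deriving DecidableEq

theorem Var.ctorIdx_injective : Function.Injective Var.ctorIdx := by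
  intro v w h
  cases v <;> cases w <;> first | rfl | cases h

theorem Table.ctorIdx_injective : Function.Injective Table.ctorIdx := by
  intro t t' h
  cases t <;> cases t' <;> first | rfl | cases h

theorem Table.ctorIdx_lt (t : Table) : t.ctorIdx < 5 := by
  cases t <;> decide

namespace State

variable (s : State)

def get (v : Var) : ℕ := s.reg v.ctorIdx

def set (v : Var) (x : ℕ) : State := { s with reg := Function.update s.reg v.ctorIdx x }

/-- The address of cell `i` of an array. -/
def address (t : Table) (i : ℕ) : ℕ := s.get .base + 5 * i + t.ctorIdx

def cell (t : Table) (i : ℕ) : ℕ := s.mem (s.address t i)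

def setCell (t : Table) (i x : ℕ) : State :=
  { s with mem := Function.update s.mem (s.address t i) x }

variable {s} {v w : Var} {t t' : Table} {i i' x : ℕ}

@[simp] theorem get_set : (s.set v x).get w = if w = v then x else s.get w := by
  simp [get, set, Function.update_apply, Var.ctorIdx_injective.eq_iff]

@[simp] theorem mem_set : (s.set v x).mem = s.mem := rfl

@[simp] theorem cell_set (hv : Var.base ≠ v) : (s.set v x).cell t = s.cell t := by
  funext i
  simp [cell, address, hv]

@[simp] theorem get_setCell : (s.setCell t i x).get v = s.get v := rfl

theorem address_inj : s.address t i = s.address t' i' ↔ t = t' ∧ i = i' := by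
  rw [← Table.ctorIdx_injective.eq_iff, address, address]
  have := t.ctorIdx_lt
  have := t'.ctorIdx_lt
  omega

@[simp] theorem cell_setCell :
    (s.setCell t i x).cell t' =
      if t' = t then Function.update (s.cell t) i x else s.cell t' := by
  funext i'
  change Function.update s.mem (s.address t i) x (s.address t' i') = _
  simp only [Function.update_apply, address_inj]
  split_ifs <;> simp_all [cell]

@[simp] theorem mem_setCell {a : ℕ} (ha : a < s.get .base) : (s.setCell t i x).mem a = s.mem a :=
  Function.update_of_ne (by rw [address]; omega) ..

end State

namespace Expr

variable {s : State}

instance : Coe Var Expr := ⟨fun v => .reg v.ctorIdx⟩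

instance (c : ℕ) : OfNat Expr c := ⟨.lit c⟩

instance : Add Expr := ⟨.add⟩

instance : Sub Expr := ⟨.sub⟩

instance : Mul Expr := ⟨.mul⟩

def address (t : Table) (i : Expr) : Expr := Var.base + 5 * i + .lit t.ctorIdx

def cell (t : Table) (i : Expr) : Expr := .mem (address t i)

@[simp] theorem eval_var (v : Var) : (v : Expr).eval s = s.get v := rfl

@[simp] theorem eval_ofNat (c : ℕ) : (no_index (OfNat.ofNat c) : Expr).eval s = c := rfl

@[simp] theorem eval_add (e f : Expr) : (e + f).eval s = e.eval s + f.eval s := rfl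

@[simp] theorem eval_sub (e f : Expr) : (e - f).eval s = e.eval s - f.eval s := rfl

@[simp] theorem eval_mul (e f : Expr) : (e * f).eval s = e.eval s * f.eval s := rfl

@[simp] theorem eval_mem (a : Expr) : (mem a).eval s = s.mem (a.eval s) := rfl

@[simp] theorem eval_lt (e f : Expr) :
    (lt e f).eval s = if e.eval s < f.eval s then 1 else 0 := rfl

@[simp] theorem eval_eq (e f : Expr) :
    (eq e f).eval s = if e.eval s = f.eval s then 1 else 0 := rfl

@[simp] theorem eval_cell (t : Table) (i : Expr) : (cell t i).eval s = s.cell t (i.eval s) := rfl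

end Expr

namespace Cmd

def set (v : Var) (e : Expr) : Cmd := .assign v.ctorIdx e

def setCell (t : Table) (i e : Expr) : Cmd := .store (.address t i) e

/-- Run `c` for `v = 0, 1, …` as long as `v < e`. -/
def forUpTo (v : Var) (e : Expr) (c : Cmd) : Cmd :=
  .seq (.set v 0) (.loop (.lt v e) (.seq c (.set v (v + 1))))

end Cmd

infix:40 "≔" => Cmd.set

infixr:35 ";;" => Cmd.seq

section WP

variable {b : ℕ} {s : State} {Q : State → Prop}

@[simp] theorem wp_skip : Cmd.skip.wp b Q s ↔ Q s := Iff.rfl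

@[simp] theorem wp_set {v : Var} {e : Expr} :
    (v ≔ e).wp b Q s ↔ e.eval s ≤ b ∧ Q (s.set v (e.eval s)) := Iff.rfl

@[simp] theorem wp_setCell {t : Table} {i e : Expr} :
    (Cmd.setCell t i e).wp b Q s ↔ e.eval s ≤ b ∧ Q (s.setCell t (i.eval s) (e.eval s)) := Iff.rfl

@[simp] theorem wp_seq {c₁ c₂ : Cmd} : (c₁ ;; c₂).wp b Q s ↔ c₁.wp b (c₂.wp b Q) s := Iff.rfl

@[simp] theorem wp_ite {e : Expr} {c₁ c₂ : Cmd} :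
    (Cmd.ite e c₁ c₂).wp b Q s ↔
      (e.eval s ≠ 0 → c₁.wp b Q s) ∧ (e.eval s = 0 → c₂.wp b Q s) := Iff.rfl

end WP

/-- The time bound has the shape that the rule requires of the body, so that it also applies to
nested loops. -/
theorem Runs.forUpTo {b M N : ℕ} {v : Var} {e : Expr} {c : Cmd} {s : State}
    (Inv : ℕ → State → Prop) (hM : 1 ≤ M) (hN : N ≤ b)
    (get_eq : ∀ j s, Inv j s → s.get v = j) (eval_eq : ∀ j s, Inv j s → e.eval s = N)
    (init : Inv 0 (s.set v 0))
    (body : ∀ j < N, ∀ s, Inv j s →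
      Runs b c s (c.cost * M) fun s' => s'.get v = j ∧ Inv (j + 1) (s'.set v (j + 1))) :
    Runs b (.forUpTo v e c) s ((Cmd.forUpTo v e c).cost * (M * (N + 1))) (Inv N) := by
  have loop_runs : Runs b (.loop (.lt v e) (c ;; (v ≔ v + 1))) (s.set v 0)
      (((Expr.lt v e).cost + 1 + (c.cost * M + (v ≔ v + 1).cost)) * (N + 1)) (Inv N) := by
    refine (Runs.loop (T := c.cost * M + (v ≔ v + 1).cost) (fun s => ∃ j ≤ N, Inv j s)
      (fun s => N - s.get v) ?_ ⟨0, Nat.zero_le _, init⟩).mono (by simp) ?_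
    · rintro s ⟨j, -, hinv⟩ hlt
      have hj : j < N := by simpa [get_eq j s hinv, eval_eq j s hinv] using hlt
      refine .seq (body j hj s hinv) fun s' hs' => .of_wp ?_
      have := get_eq j s hinv
      simp only [wp_set, Expr.eval_add, Expr.eval_var, Expr.eval_ofNat, hs'.1]
      exact ⟨by omega, ⟨j + 1, hj, hs'.2⟩, by simp; omega⟩
    · rintro s ⟨⟨j, hj, hinv⟩, he⟩
      have : N ≤ j := by simpa [get_eq j s hinv, eval_eq j s hinv] using he
      rwa [← hj.antisymm this]
  refine (Runs.of_wp_seq (c₁ := v ≔ 0) ⟨Nat.zero_le b, loop_runs⟩).mono ?_ fun _ h => h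
  set P := M * (N + 1) with hP
  have one_le : 1 ≤ P := Nat.mul_pos hM N.succ_pos
  have le_P : N + 1 ≤ P := Nat.le_mul_of_pos_left _ hM
  calc (v ≔ 0).cost + ((Expr.lt v e).cost + 1 + (c.cost * M + (v ≔ v + 1).cost)) * (N + 1)
      = (v ≔ 0).cost * 1 + ((Expr.lt v e).cost + 1 + (v ≔ v + 1).cost) * (N + 1) + c.cost * P := by
        rw [hP]; ring
    _ ≤ (v ≔ 0).cost * P + ((Expr.lt v e).cost + 1 + (v ≔ v + 1).cost) * P + c.cost * P := by
        gcongr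
    _ = (Cmd.forUpTo v e c).cost * P := by simp only [Cmd.forUpTo, Cmd.cost]; ring

end WordRAM

namespace GNSPM

variable (I : GNSPM)

/-! ### The words of an instance -/

/-- The preference list of agent `a`, where the agents `u_0, …, u_{n-1}, w_0, …, w_{n-1}` are
numbered consecutively. -/
def prefList (a : ℕ) : List ℕ :=
  if h : a < I.n then (I.profile.prefU ⟨a, h⟩).map Fin.val
  else if h : a - I.n < I.n then (I.profile.prefW ⟨a - I.n, h⟩).map Fin.val
  else []

theorem prefList_val (u : Fin I.n) : I.prefList u = (I.profile.prefU u).map Fin.val := by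
  simp [prefList]

theorem prefList_add_val (w : Fin I.n) :
    I.prefList (I.n + w) = (I.profile.prefW w).map Fin.val := by
  simp [prefList]

theorem nodup_prefList (a : ℕ) : (I.prefList a).Nodup := by
  unfold prefList
  split_ifs
  exacts [(I.profile.nodupU _).map Fin.val_injective, (I.profile.nodupW _).map Fin.val_injective,
    List.nodup_nil]

variable {I} in
theorem lt_of_mem_prefList {a x : ℕ} (h : x ∈ I.prefList a) : x < I.n := by
  unfold prefList at h
  split_ifs at h
  · obtain ⟨y, -, rfl⟩ := List.mem_map.1 h
    exact y.2
  · obtain ⟨y, -, rfl⟩ := List.mem_map.1 h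
    exact y.2
  · simp at h

theorem length_prefList_le (a : ℕ) : (I.prefList a).length ≤ I.n := by
  have subset : I.prefList a ⊆ List.range I.n := fun x hx =>
    List.mem_range.2 (lt_of_mem_prefList hx)
  simpa using ((I.nodup_prefList a).subperm subset).length_le

/-- The part of the input that precedes the preference list of agent `a`. -/
def wordsBefore (a : ℕ) : List ℕ :=
  I.n :: I.d :: (List.range a).flatMap fun a' => (I.prefList a').length :: I.prefList a'

theorem wordsBefore_succ (a : ℕ) :
    I.wordsBefore (a + 1) = I.wordsBefore a ++ (I.prefList a).length :: I.prefList a := by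
  simp [wordsBefore, List.range_succ]

theorem wordsBefore_isPrefix {a a' : ℕ} (h : a ≤ a') : I.wordsBefore a <+: I.wordsBefore a' := by
  induction h with
  | refl => exact List.prefix_rfl
  | step _ ih => exact ih.trans (I.wordsBefore_succ _ ▸ List.prefix_append ..)

theorem encode_eq : I.encode = I.wordsBefore (2 * I.n) := by
  have h : List.range I.n = (List.finRange I.n).map Fin.val := by simp
  rw [wordsBefore, two_mul, List.range_add, List.flatMap_append, List.flatMap_map, h,
    List.flatMap_map, List.flatMap_map]
  simp only [encode, encodeList, prefList_val, prefList_add_val, List.length_map]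

/-- The address of the first word of the preference list of agent `a`. -/
def offset (a : ℕ) : ℕ := (I.wordsBefore a).length

theorem offset_succ (a : ℕ) : I.offset (a + 1) = I.offset a + (I.prefList a).length + 1 := by
  rw [offset, wordsBefore_succ, List.length_append, List.length_cons, offset, add_assoc]

theorem size_eq_offset : I.size = I.offset (2 * I.n) := by rw [size, encode_eq, offset]

theorem offset_succ_le_size {a : ℕ} (ha : a < 2 * I.n) : I.offset (a + 1) ≤ I.size := by
  rw [size_eq_offset]
  exact (I.wordsBefore_isPrefix ha).length_le

theorem offset_le (a : ℕ) : I.offset a ≤ 2 + a * (I.n + 1) := by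
  induction a with
  | zero => simp [offset, wordsBefore]
  | succ a ih =>
    rw [offset_succ]
    linarith [I.length_prefList_le a]

theorem le_offset (a : ℕ) : 2 + a ≤ I.offset a := by
  induction a with
  | zero => rfl
  | succ a ih => rw [offset_succ]; omega

theorem size_le : I.size ≤ 2 * (I.n + 1) ^ 2 := by
  have := I.offset_le (2 * I.n)
  rw [size_eq_offset]
  nlinarith

theorem le_size : 2 * I.n + 2 ≤ I.size := by
  rw [size_eq_offset, add_comm]
  exact I.le_offset _

/-- The word of the input at the address `i`. -/
def word (i : ℕ) : ℕ := I.encode.getD i 0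

theorem word_zero : I.word 0 = I.n := rfl

theorem word_offset_add {a j : ℕ} (ha : a < 2 * I.n) (hj : j ≤ (I.prefList a).length) :
    I.word (I.offset a + j) = ((I.prefList a).length :: I.prefList a).getD j 0 := by
  obtain ⟨rest, h⟩ := I.wordsBefore_isPrefix (Nat.succ_le_of_lt ha)
  rw [word, encode_eq, ← h, wordsBefore_succ, offset, List.append_assoc,
    List.getD_append_right _ _ _ _ (by omega), Nat.add_sub_cancel_left,
    List.getD_append _ _ _ _ (by rw [List.length_cons]; omega)]

theorem word_offset {a : ℕ} (ha : a < 2 * I.n) : I.word (I.offset a) = (I.prefList a).length :=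
  I.word_offset_add ha (Nat.zero_le _)

theorem word_offset_add_succ {a j : ℕ} (ha : a < 2 * I.n) (hj : j < (I.prefList a).length) :
    I.word (I.offset a + j + 1) = (I.prefList a)[j] := by
  rw [add_assoc, I.word_offset_add ha hj, List.getD_cons_succ, List.getD_eq_getElem _ _ hj]

theorem word_le (i : ℕ) : I.word i ≤ I.size + I.d := by
  have n_le := I.le_size
  have le_of_mem : ∀ x ∈ I.encode, x ≤ I.size + I.d := by
    rw [encode_eq]
    intro x hx
    rw [wordsBefore, List.mem_cons, List.mem_cons, List.mem_flatMap] at hx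
    rcases hx with rfl | rfl | ⟨a, -, hx⟩
    · omega
    · omega
    · rcases List.mem_cons.1 hx with rfl | hx
      · have := I.length_prefList_le a; omega
      · have := lt_of_mem_prefList hx; omega
  by_cases h : i < I.encode.length
  · rw [word, List.getD_eq_getElem _ _ h]
    exact le_of_mem _ (List.getElem_mem h)
  · rw [word, List.getD_eq_default _ _ (not_lt.1 h)]
    exact Nat.zero_le _

/-- A bound for all numbers that the algorithms write. -/
def bound : ℕ := (I.size + I.d) ^ 4

variable {I}

theorem two_le_bound : 2 ≤ I.bound := by
  have := I.le_size
  exact (show 2 ≤ I.size + I.d by omega).trans (Nat.le_self_pow (by norm_num) _)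

theorem le_bound_of_le_pow {x k : ℕ} (hk : k ≤ 4) (h : x ≤ (I.size + I.d) ^ k) : x ≤ I.bound :=
  h.trans (Nat.pow_le_pow_right (by have := I.le_size; omega) hk)

theorem le_bound {x : ℕ} (h : x ≤ I.size + I.d) : x ≤ I.bound :=
  le_bound_of_le_pow (k := 1) (by norm_num) (by simpa using h)

theorem two_mul_sq_le_bound : 2 * (I.n + 1) ^ 2 ≤ I.bound := by
  refine le_bound_of_le_pow (k := 2) (by norm_num) ?_
  have : (2 * (I.n + 1)) ^ 2 ≤ (I.size + I.d) ^ 2 :=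
    Nat.pow_le_pow_left (by have := I.le_size; omega) 2
  nlinarith

end GNSPM

/-- The position of `x` in the list, counted from `1`, and `0` if `x` is not in the list. -/
def rankIn (l : List ℕ) (x : ℕ) : ℕ := if x ∈ l then l.idxOf x + 1 else 0

/-- One more than the `i`-th member of the list, and `0` past the end of the list. -/
def entryIn (l : List ℕ) (i : ℕ) : ℕ := (l.map (· + 1)).getD i 0

theorem rankIn_append_singleton {l : List ℕ} {y : ℕ} (hy : y ∉ l) (x : ℕ) :
    rankIn (l ++ [y]) x = if x = y then l.length + 1 else rankIn l x := by
  by_cases hx : x = y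
  · simp [hx, rankIn, List.idxOf_append, hy]
  · by_cases hl : x ∈ l <;> simp [hx, hl, rankIn, List.idxOf_append]

theorem entryIn_append_singleton (l : List ℕ) (y i : ℕ) :
    entryIn (l ++ [y]) i = if i = l.length then y + 1 else entryIn l i := by
  rw [entryIn, entryIn, List.map_append]
  rcases lt_trichotomy i l.length with h | rfl | h
  · rw [List.getD_append _ _ _ _ (by simpa using h), if_neg h.ne]
  · rw [List.getD_append_right _ _ _ _ (by simp)]
    simp
  · rw [if_neg h.ne', List.getD_eq_default _ _ (by simpa using h),
      List.getD_eq_default _ _ (by simpa using h.le)]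

/-! ### Reading the input -/

theorem mul_add_inj_of_lt {m a x a' x' : ℕ} (hx : x < m) (hx' : x' < m) :
    a * m + x = a' * m + x' ↔ a = a' ∧ x = x' := by
  have hm : 0 < m := by omega
  refine ⟨fun h => ?_, fun h => by rw [h.1, h.2]⟩
  have hdiv := congrArg (· / m) h
  have hmod := congrArg (· % m) h
  simp only [Nat.mul_comm _ m, Nat.mul_add_div hm, Nat.mul_add_mod, Nat.div_eq_of_lt hx,
    Nat.div_eq_of_lt hx', Nat.mod_eq_of_lt hx, Nat.mod_eq_of_lt hx', add_zero] at hdiv hmod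
  exact ⟨hdiv, hmod⟩

namespace GNSPM

variable (I : GNSPM)

/-- The part of the list of agent `a'` that has been read after all lists of the agents before `a`
and `j` members of the list of `a`. -/
def readPart (a j a' : ℕ) : List ℕ :=
  if a' < a then I.prefList a' else if a' = a then (I.prefList a).take j else []

theorem readPart_self (a j : ℕ) : I.readPart a j a = (I.prefList a).take j := by
  simp [readPart]

theorem readPart_succ {a j : ℕ} (hj : j < (I.prefList a).length) :
    I.readPart a (j + 1) =
      Function.update (I.readPart a j) a (I.readPart a j a ++ [(I.prefList a)[j]]) := by
  funext a'
  by_cases h : a' = a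
  · rw [h, Function.update_self, readPart_self, readPart_self, List.take_append_getElem]
  · simp [h, readPart]

theorem readPart_length (a : ℕ) : I.readPart a (I.prefList a).length = I.readPart (a + 1) 0 := by
  funext a'
  rcases lt_trichotomy a' a with h | rfl | h
  · simp [readPart, h, Nat.lt_succ_of_lt h]
  · simp [readPart]
  · simp [readPart, h.not_gt, h.ne', not_lt.2 (Nat.succ_le_of_lt h)]

theorem getElem_notMem_readPart {a j : ℕ} (hj : j < (I.prefList a).length) :
    (I.prefList a)[j] ∉ I.readPart a j a := by
  rw [readPart_self, List.mem_take_iff_getElem]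
  rintro ⟨i, hi, h⟩
  have := (I.nodup_prefList a).getElem_inj_iff.1 h
  omega

end GNSPM

namespace WordRAM

open Var Table

variable {I : GNSPM} {L : ℕ → List ℕ} {s : State}

/-- The arrays `rank` and `entry` hold the positions and the members of the lists `L a`, the input
is intact, and the variables that describe the layout of the memory are set. -/
structure Tabulates (I : GNSPM) (L : ℕ → List ℕ) (s : State) : Prop where
  get_n : s.get n = I.n
  get_rowLength : s.get rowLength = I.n + 1
  get_base : s.get base = 2 * (I.n + 1) ^ 2
  mem_eq : ∀ i < 2 * (I.n + 1) ^ 2, s.mem i = I.word i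
  rank_eq : ∀ a < 2 * I.n, ∀ x ≤ I.n, s.cell rank (a * (I.n + 1) + x) = rankIn (L a) x
  entry_eq : ∀ a < 2 * I.n, ∀ i ≤ I.n, s.cell entry (a * (I.n + 1) + i) = entryIn (L a) i

namespace Tabulates

@[simp] theorem set_iff {v : Var} {x : ℕ} (hn : n ≠ v) (hr : rowLength ≠ v) (hb : base ≠ v) :
    Tabulates I L (s.set v x) ↔ Tabulates I L s := by
  refine ⟨fun ⟨h₁, h₂, h₃, h₄, h₅, h₆⟩ => ?_, fun ⟨h₁, h₂, h₃, h₄, h₅, h₆⟩ => ?_⟩ <;>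
    constructor <;> simp_all

@[simp] theorem setCell_iff {t : Table} {i x : ℕ} (hr : rank ≠ t) (he : entry ≠ t) :
    Tabulates I L (s.setCell t i x) ↔ Tabulates I L s := by
  have (hb : s.get base = 2 * (I.n + 1) ^ 2) (a : ℕ) (ha : a < 2 * (I.n + 1) ^ 2) :
      (s.setCell t i x).mem a = s.mem a := State.mem_setCell (hb ▸ ha)
  refine ⟨fun ⟨h₁, h₂, h₃, h₄, h₅, h₆⟩ => ?_, fun ⟨h₁, h₂, h₃, h₄, h₅, h₆⟩ => ?_⟩ <;>
    constructor <;> simp_all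

theorem mem_one (h : Tabulates I L s) : s.mem 1 = I.d :=
  h.mem_eq 1 (by have := Nat.one_le_pow 2 (I.n + 1) I.n.succ_pos; omega)

theorem append (h : Tabulates I L s) {a y : ℕ} (hL : (L a).length ≤ I.n) (hy : y ≤ I.n)
    (hyL : y ∉ L a) :
    Tabulates I (Function.update L a (L a ++ [y]))
      ((s.setCell rank (a * (I.n + 1) + y) ((L a).length + 1)).setCell entry
        (a * (I.n + 1) + (L a).length) (y + 1)) where
  get_n := h.get_n
  get_rowLength := h.get_rowLength
  get_base := h.get_base
  mem_eq i hi := by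
    rw [← h.get_base] at hi
    rw [State.mem_setCell (by exact hi), State.mem_setCell hi, h.mem_eq i (h.get_base ▸ hi)]
  rank_eq a' ha' x hx := by
    have hinj := mul_add_inj_of_lt (a := a') (a' := a) (Nat.lt_succ_of_le hx) (Nat.lt_succ_of_le hy)
    by_cases haa : a' = a
    · subst haa
      simp [Function.update_apply, rankIn_append_singleton hyL, h.rank_eq a' ha' x hx]
    · simp [hinj, haa, h.rank_eq a' ha' x hx]
  entry_eq a' ha' i hi := by
    have hinj := mul_add_inj_of_lt (a := a') (a' := a) (Nat.lt_succ_of_le hi) (Nat.lt_succ_of_le hL)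
    by_cases haa : a' = a
    · subst haa
      simp [Function.update_apply, entryIn_append_singleton, h.entry_eq a' ha' i hi]
    · simp [hinj, haa, h.entry_eq a' ha' i hi]

end Tabulates

/-- The preference lists of the instance have been read. -/
abbrev Ready (I : GNSPM) : State → Prop := Tabulates I I.prefList

/-- The program that reads the next word of the input: `agent` is the agent whose list is being
read, `pointer` the address of this list, and `column` the number of its members read so far. -/
def readStep : Cmd :=
  .ite (.lt column (.mem pointer))
    (candidate ≔ .mem (pointer + column + 1) ;;
      .setCell rank (agent * rowLength + candidate) (column + 1) ;;
      .setCell entry (agent * rowLength + column) (candidate + 1) ;;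
      column ≔ column + 1)
    (pointer ≔ pointer + .mem pointer + 1 ;;
      column ≔ 0 ;;
      agent ≔ agent + 1)

/-- The program that reads the first word of the input and goes to the first list. -/
def readSetup : Cmd :=
  n ≔ .mem 0 ;;
  rowLength ≔ n + 1 ;;
  base ≔ 2 * (rowLength * rowLength) ;;
  agent ≔ 0 ;;
  pointer ≔ 2 ;;
  column ≔ 0

def readLoop : Cmd := .loop (.lt agent (2 * n)) readStep

/-- The program that reads the preference lists into the arrays `rank` and `entry`. -/
def readInput : Cmd := readSetup ;; readLoop

/-- The invariant of reading: the next word to be read is the member `j` of the list of agent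
`a`. -/
structure ReadInv (I : GNSPM) (a j : ℕ) (s : State) : Prop where
  tabulates : Tabulates I (I.readPart a j) s
  cell_eq_zero : ∀ t, t ≠ rank → t ≠ entry → s.cell t = 0
  get_agent : s.get agent = a
  get_pointer : s.get pointer = I.offset a
  get_column : s.get column = j
  agent_le : a ≤ 2 * I.n
  column_le : j ≤ (I.prefList a).length

namespace ReadInv

variable {a j : ℕ}

theorem read_member (h : ReadInv I a j s) (ha : a < 2 * I.n) (hj : j < (I.prefList a).length) :
    ReadInv I a (j + 1)
      ((((s.set candidate (I.prefList a)[j]).setCell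
        rank (a * (I.n + 1) + (I.prefList a)[j]) (j + 1)).setCell
          entry (a * (I.n + 1) + j) ((I.prefList a)[j] + 1)).set column (j + 1)) := by
  have hy := GNSPM.lt_of_mem_prefList (List.getElem_mem hj)
  have length_le := I.length_prefList_le a
  have length_part : (I.readPart a j a).length = j := by
    rw [I.readPart_self, List.length_take_of_le hj.le]
  have tabulates := ((Tabulates.set_iff (v := candidate) (x := (I.prefList a)[j])
    (by decide) (by decide) (by decide)).2 h.tabulates).append
      (length_part.trans_le (by omega)) hy.le (I.getElem_notMem_readPart hj)
  rw [← I.readPart_succ hj, length_part] at tabulates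
  refine ⟨by simpa using tabulates, fun t hr he => ?_, ?_, ?_, ?_, ha.le, hj⟩
  · simp [hr, he, h.cell_eq_zero]
  · simp [h.get_agent]
  · simp [h.get_pointer]
  · simp

theorem next_agent (h : ReadInv I a (I.prefList a).length s) (ha : a < 2 * I.n) :
    ReadInv I (a + 1) 0
      (((s.set pointer (I.offset (a + 1))).set column 0).set agent (a + 1)) := by
  refine ⟨?_, fun t hr he => by simp [h.cell_eq_zero t hr he], by simp, by simp, by simp, ha,
    Nat.zero_le _⟩
  simpa [← I.readPart_length] using h.tabulates

end ReadInv

theorem readStep_runs {a j : ℕ} (h : ReadInv I a j s) (ha : a < 2 * I.n) :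
    Runs I.bound readStep s readStep.cost fun s' =>
      ∃ a' j', ReadInv I a' j' s' ∧ I.offset a' + j' = I.offset a + j + 1 := by
  have offset_le := I.offset_succ_le_size ha
  have size_le := I.size_le
  have le_size := I.le_size
  have length_le := I.length_prefList_le a
  rw [I.offset_succ] at offset_le
  have mem_pointer : s.mem (I.offset a) = (I.prefList a).length := by
    rw [h.tabulates.mem_eq _ (by omega), I.word_offset ha]
  refine .of_wp ⟨fun hlt => ?_, fun hge => ?_⟩
  · have hj : j < (I.prefList a).length := by
      simpa [h.get_column, h.get_pointer, mem_pointer] using hlt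
    have hy := GNSPM.lt_of_mem_prefList (List.getElem_mem hj)
    have mem_next : s.mem (I.offset a + j + 1) = (I.prefList a)[j] := by
      rw [h.tabulates.mem_eq _ (by omega), I.word_offset_add_succ ha hj]
    have hread : ReadInv I a (j + 1) _ := h.read_member ha hj
    have value_le : (I.prefList a)[j] + 1 ≤ I.bound ∧ j + 1 ≤ I.bound :=
      ⟨GNSPM.le_bound (by omega), GNSPM.le_bound (by omega)⟩
    simpa [h.get_column, h.get_pointer, h.get_agent, mem_next, h.tabulates.get_rowLength, value_le,
      value_le.1.trans' (Nat.le_succ _)] using ⟨a, j + 1, hread, by omega⟩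
  · obtain rfl : j = (I.prefList a).length :=
      h.column_le.antisymm (by simpa [h.get_column, h.get_pointer, mem_pointer] using hge)
    have hread : ReadInv I (a + 1) 0 _ := h.next_agent ha
    rw [I.offset_succ] at hread
    have value_le : I.offset a + (I.prefList a).length + 1 ≤ I.bound ∧ a + 1 ≤ I.bound :=
      ⟨GNSPM.le_bound (by omega), GNSPM.le_bound (by omega)⟩
    simpa [h.get_pointer, h.get_agent, mem_pointer, value_le] using
      ⟨a + 1, 0, hread, I.offset_succ a⟩

theorem cell_eq_zero_of_mem_eq (hmem : s.mem = (State.init I.encode).mem)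
    (hbase : s.get base = 2 * (I.n + 1) ^ 2) (t : Table) : s.cell t = 0 := by
  funext i
  have size_le := I.size_le
  have le_address : I.size ≤ s.address t i := by rw [State.address, hbase]; omega
  rw [State.cell, hmem]
  exact List.getD_eq_default _ _ le_address

theorem readInv_zero (hmem : s.mem = (State.init I.encode).mem) (hn : s.get n = I.n)
    (hr : s.get rowLength = I.n + 1) (hb : s.get base = 2 * (I.n + 1) ^ 2)
    (ha : s.get agent = 0) (hp : s.get pointer = 2) (hc : s.get column = 0) :
    ReadInv I 0 0 s where
  tabulates :=
    { get_n := hn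
      get_rowLength := hr
      get_base := hb
      mem_eq i _ := congrFun hmem i
      rank_eq := by simp [cell_eq_zero_of_mem_eq hmem hb, rankIn, GNSPM.readPart]
      entry_eq := by simp [cell_eq_zero_of_mem_eq hmem hb, entryIn, GNSPM.readPart] }
  cell_eq_zero t _ _ := cell_eq_zero_of_mem_eq hmem hb t
  get_agent := ha
  get_pointer := hp
  get_column := hc
  agent_le := Nat.zero_le _
  column_le := Nat.zero_le _

theorem readSetup_runs :
    Runs I.bound readSetup (.init I.encode) readSetup.cost (ReadInv I 0 0) := by
  have le_size := I.le_size
  have two_le : 2 ≤ I.bound := GNSPM.two_le_bound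
  have n_le : I.n + 1 ≤ I.bound := GNSPM.le_bound (by omega)
  have base_le := GNSPM.two_mul_sq_le_bound (I := I)
  have mem_zero : (State.init I.encode).mem 0 = I.n := I.word_zero
  refine .of_wp ?_
  simp only [readSetup, wp_seq, wp_set, Expr.eval_mem, Expr.eval_ofNat, Expr.eval_add,
    Expr.eval_mul, Expr.eval_var, State.get_set, mem_zero, ← sq,
    if_true]
  refine ⟨by omega, n_le, base_le, Nat.zero_le _, two_le, Nat.zero_le _, readInv_zero rfl ?_ ?_ ?_
    ?_ ?_ ?_⟩ <;> simp

theorem readLoop_runs (hs : ReadInv I 0 0 s) :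
    Runs I.bound readLoop s (readLoop.cost * I.size) fun s =>
      Ready I s ∧ ∀ t, t ≠ rank → t ≠ entry → s.cell t = 0 := by
  refine (Runs.loop (T := readStep.cost) (fun s => ∃ a j, ReadInv I a j s)
    (fun s => I.size - (s.get pointer + s.get column)) (fun s ⟨a, j, h⟩ hlt => ?_)
    ⟨0, 0, hs⟩).mono ?_ ?_
  · have ha : a < 2 * I.n := by simpa [h.get_agent, h.tabulates.get_n] using hlt
    refine (readStep_runs h ha).mono le_rfl ?_
    rintro s' ⟨a', j', h', hnext⟩
    have offset_le := I.offset_succ_le_size ha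
    have := h.column_le
    rw [I.offset_succ] at offset_le
    rw [h.get_pointer, h.get_column, h'.get_pointer, h'.get_column]
    exact ⟨⟨a', j', h'⟩, by omega⟩
  · rw [hs.get_pointer, hs.get_column]
    refine Nat.mul_le_mul_left _ ?_
    have := I.le_size
    have := I.le_offset 0
    omega
  · rintro s' ⟨⟨a, j, h⟩, hge⟩
    obtain rfl : a = 2 * I.n :=
      h.agent_le.antisymm (by simpa [h.get_agent, h.tabulates.get_n] using hge)
    have part_eq {a' : ℕ} (ha' : a' < 2 * I.n) : I.readPart (2 * I.n) j a' = I.prefList a' :=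
      if_pos ha'
    refine ⟨{ h.tabulates with rank_eq := ?_, entry_eq := ?_ }, h.cell_eq_zero⟩
    · intro a' ha' x hx
      rw [h.tabulates.rank_eq a' ha' x hx, part_eq ha']
    · intro a' ha' i hi
      rw [h.tabulates.entry_eq a' ha' i hi, part_eq ha']

theorem readInput_runs :
    Runs I.bound readInput (.init I.encode) (readInput.cost * I.size) fun s =>
      Ready I s ∧ ∀ t, t ≠ rank → t ≠ entry → s.cell t = 0 := by
  refine (readSetup_runs.seq fun _ => readLoop_runs).mono ?_ fun _ h => h
  have : 1 ≤ I.size := by have := I.le_size; omega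
  calc readSetup.cost + readLoop.cost * I.size
      ≤ readSetup.cost * I.size + readLoop.cost * I.size := by
        gcongr
        exact Nat.le_mul_of_pos_right _ this
    _ = readInput.cost * I.size := (add_mul ..).symm

theorem init_bdd : (State.init I.encode).Bdd I.bound :=
  ⟨fun _ => Nat.zero_le _, fun a => GNSPM.le_bound (I.word_le a)⟩

end WordRAM

/-! ### Deferred acceptance -/

theorem idxOf_map_of_injective {α β : Type*} [DecidableEq α] [DecidableEq β] {f : α → β}
    (hf : Function.Injective f) (l : List α) (x : α) : (l.map f).idxOf (f x) = l.idxOf x := by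
  induction l with
  | nil => rfl
  | cons y l ih => simp [List.idxOf_cons, hf.beq_eq, ih]

namespace GNSPM

variable {I : GNSPM}

theorem mem_prefList_val {u w : Fin I.n} : (w : ℕ) ∈ I.prefList u ↔ w ∈ I.profile.prefU u := by
  rw [prefList_val, List.mem_map_of_injective Fin.val_injective]

theorem mem_prefList_add_val {u w : Fin I.n} :
    (u : ℕ) ∈ I.prefList (I.n + w) ↔ u ∈ I.profile.prefW w := by
  rw [prefList_add_val, List.mem_map_of_injective Fin.val_injective]

theorem idxOf_prefList_val (u w : Fin I.n) :
    (I.prefList u).idxOf (w : ℕ) = I.profile.rkU u w := by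
  rw [prefList_val, idxOf_map_of_injective Fin.val_injective, Profile.rkU]

theorem idxOf_prefList_add_val (u w : Fin I.n) :
    (I.prefList (I.n + w)).idxOf (u : ℕ) = I.profile.rkW w u := by
  rw [prefList_add_val, idxOf_map_of_injective Fin.val_injective, Profile.rkW]

/-- A situation in the course of deferred acceptance: `p u` is the number of agents to whom `u` has
proposed, and `m w` is `u + 1` if `w` is engaged to `u`, and `0` if `w` is free. -/
structure Courtship (I : GNSPM) (p m : ℕ → ℕ) : Prop where
  proposals_le : ∀ u < I.n, p u ≤ (I.prefList u).length
  suitor_lt : ∀ {u w}, m w = u + 1 → u < I.n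
  suitor_acceptable : ∀ {u w}, m w = u + 1 → u ∈ I.prefList (I.n + w)
  fiance_mem : ∀ {u w}, m w = u + 1 → w ∈ I.prefList u
  proposals_eq : ∀ {u w}, m w = u + 1 → p u = (I.prefList u).idxOf w + 1
  le_suitor : ∀ u < I.n, ∀ w ∈ I.prefList u, (I.prefList u).idxOf w < p u →
    u ∈ I.prefList (I.n + w) →
      ∃ v, m w = v + 1 ∧ (I.prefList (I.n + w)).idxOf v ≤ (I.prefList (I.n + w)).idxOf u

/-- The pairs of engaged agents. -/
def engagements (I : GNSPM) (m : ℕ → ℕ) : Finset (Fin I.n × Fin I.n) :=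
  Finset.univ.filter fun p => m p.2 = p.1 + 1

theorem mem_engagements {m : ℕ → ℕ} {u w : Fin I.n} :
    (u, w) ∈ I.engagements m ↔ m w = u + 1 := by
  simp [engagements]

theorem engagements_snd_inj {m : ℕ → ℕ} {q q' : Fin I.n × Fin I.n}
    (hq : q ∈ I.engagements m) (hq' : q' ∈ I.engagements m) (heq : q.2 = q'.2) : q = q' := by
  have hm := mem_engagements.1 hq
  have hm' := mem_engagements.1 hq'
  rw [heq, hm'] at hm
  exact Prod.ext (Fin.ext (Nat.succ.inj hm).symm) heq

/-- The number of agents of `W` that are engaged. -/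
def numEngaged (I : GNSPM) (m : ℕ → ℕ) : ℕ := ((Finset.range I.n).filter fun w => m w ≠ 0).card

theorem numEngaged_le (m : ℕ → ℕ) : I.numEngaged m ≤ I.n := by
  simpa [numEngaged] using Finset.card_filter_le (Finset.range I.n) fun w => m w ≠ 0

theorem numEngaged_update_of_eq_zero {m : ℕ → ℕ} {w : ℕ} (hw : w < I.n) (hm : m w = 0) (u : ℕ) :
    I.numEngaged (Function.update m w (u + 1)) = I.numEngaged m + 1 := by
  have : ((Finset.range I.n).filter fun w' => Function.update m w (u + 1) w' ≠ 0) =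
      insert w ((Finset.range I.n).filter fun w' => m w' ≠ 0) := by
    ext w'
    by_cases h : w' = w <;> simp [h, hw]
  rw [numEngaged, this, Finset.card_insert_of_notMem (by simp [hm]), numEngaged]

theorem numEngaged_update_of_ne_zero {m : ℕ → ℕ} {w : ℕ} (hm : m w ≠ 0) (u : ℕ) :
    I.numEngaged (Function.update m w (u + 1)) = I.numEngaged m := by
  refine congrArg Finset.card (Finset.filter_congr fun w' _ => ?_)
  by_cases h : w' = w <;> simp [h, hm]

namespace Courtship

variable {p m : ℕ → ℕ} {u w : ℕ}

theorem init (I : GNSPM) : Courtship I 0 0 where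
  proposals_le _ _ := Nat.zero_le _
  suitor_lt h := by simp at h
  suitor_acceptable h := by simp at h
  fiance_mem h := by simp at h
  proposals_eq h := by simp at h
  le_suitor _ _ _ _ h := by simp at h

theorem fiance_unique (h : Courtship I p m) {w' : ℕ} (hw : m w = u + 1) (hw' : m w' = u + 1) :
    w = w' := by
  have := (h.proposals_eq hw).symm.trans (h.proposals_eq hw')
  exact (List.idxOf_inj (h.fiance_mem hw)).1 (Nat.succ.inj this)

theorem proposals_update_le (h : Courtship I p m) (hw : w ∈ I.prefList u)
    (hp : (I.prefList u).idxOf w = p u) :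
    ∀ v < I.n, Function.update p u (p u + 1) v ≤ (I.prefList v).length := by
  intro v hv
  rw [Function.update_apply]
  split_ifs with hvu
  · subst hvu
    exact hp ▸ List.idxOf_lt_length_of_mem hw
  · exact h.proposals_le v hv

theorem proposed_before (hw : w ∈ I.prefList u) (hp : (I.prefList u).idxOf w = p u) {v w' : ℕ}
    (hw' : w' ∈ I.prefList v) (hlt : (I.prefList v).idxOf w' < Function.update p u (p u + 1) v) :
    (v = u ∧ w' = w) ∨ (I.prefList v).idxOf w' < p v := by
  rw [Function.update_apply] at hlt
  split_ifs at hlt with hvu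
  · subst hvu
    refine (Nat.lt_succ_iff_lt_or_eq.1 hlt).symm.imp (fun heq => ⟨rfl, ?_⟩) id
    exact (List.idxOf_inj hw').1 (heq.trans hp.symm)
  · exact .inr hlt

theorem reject (h : Courtship I p m) (free : ∀ w, m w ≠ u + 1) (hw : w ∈ I.prefList u)
    (hp : (I.prefList u).idxOf w = p u)
    (better : u ∈ I.prefList (I.n + w) →
      ∃ v, m w = v + 1 ∧ (I.prefList (I.n + w)).idxOf v ≤ (I.prefList (I.n + w)).idxOf u) :
    Courtship I (Function.update p u (p u + 1)) m where
  proposals_le := h.proposals_update_le hw hp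
  suitor_lt := h.suitor_lt
  suitor_acceptable := h.suitor_acceptable
  fiance_mem := h.fiance_mem
  proposals_eq {v w'} hv := by
    have hvu : v ≠ u := fun hvu => free w' (hvu ▸ hv)
    rw [Function.update_of_ne hvu, h.proposals_eq hv]
  le_suitor v hv w' hw' hlt hacc := by
    rcases proposed_before hw hp hw' hlt with ⟨rfl, rfl⟩ | hlt
    exacts [better hacc, h.le_suitor v hv w' hw' hlt hacc]

theorem engage (h : Courtship I p m) (hu : u < I.n) (free : ∀ w, m w ≠ u + 1)
    (hw : w ∈ I.prefList u) (hp : (I.prefList u).idxOf w = p u) (hacc : u ∈ I.prefList (I.n + w))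
    (worse : ∀ v, m w = v + 1 →
      (I.prefList (I.n + w)).idxOf u < (I.prefList (I.n + w)).idxOf v) :
    Courtship I (Function.update p u (p u + 1)) (Function.update m w (u + 1)) := by
  have engaged_cases {v w' : ℕ} (hv : Function.update m w (u + 1) w' = v + 1) :
      (v = u ∧ w' = w) ∨ (v ≠ u ∧ m w' = v + 1) := by
    rw [Function.update_apply] at hv
    split_ifs at hv with hww
    · exact .inl ⟨by omega, hww⟩
    · exact .inr ⟨fun hvu => free w' (hvu ▸ hv), hv⟩
  refine ⟨h.proposals_update_le hw hp, fun hv => ?_, fun hv => ?_, fun hv => ?_, fun hv => ?_,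
    fun v hv w' hw' hlt hacc' => ?_⟩
  · rcases engaged_cases hv with ⟨rfl, rfl⟩ | ⟨-, hv⟩
    exacts [hu, h.suitor_lt hv]
  · rcases engaged_cases hv with ⟨rfl, rfl⟩ | ⟨-, hv⟩
    exacts [hacc, h.suitor_acceptable hv]
  · rcases engaged_cases hv with ⟨rfl, rfl⟩ | ⟨-, hv⟩
    exacts [hw, h.fiance_mem hv]
  · rcases engaged_cases hv with ⟨rfl, rfl⟩ | ⟨hvu, hv⟩
    · rw [Function.update_self, hp]
    · rw [Function.update_of_ne hvu, h.proposals_eq hv]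
  · rcases proposed_before hw hp hw' hlt with ⟨rfl, rfl⟩ | hlt
    · exact ⟨v, Function.update_self .., le_rfl⟩
    · obtain ⟨v', hv', hle⟩ := h.le_suitor v hv w' hw' hlt hacc'
      by_cases hww : w' = w
      · subst hww
        exact ⟨u, Function.update_self .., (worse v' hv').le.trans hle⟩
      · exact ⟨v', by rwa [Function.update_of_ne hww], hle⟩

theorem isMatching_engagements (h : Courtship I p m) :
    I.profile.IsMatching (I.engagements m) := by
  refine ⟨fun q hq => ?_, fun q hq q' hq' hne => ⟨fun heq => hne ?_, fun heq => hne ?_⟩⟩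
  · have hm := mem_engagements.1 hq
    exact ⟨mem_prefList_val.1 (h.fiance_mem hm), mem_prefList_add_val.1 (h.suitor_acceptable hm)⟩
  · have hm := mem_engagements.1 hq
    have hm' := mem_engagements.1 hq'
    rw [← heq] at hm'
    exact Prod.ext heq (Fin.ext (h.fiance_unique hm hm'))
  · exact engagements_snd_inj hq hq' heq

theorem isStable_engagements (h : Courtship I p m)
    (settled : ∀ u < I.n, (∃ w, m w = u + 1) ∨ p u = (I.prefList u).length) :
    I.profile.IsStable (I.engagements m) := by
  refine ⟨h.isMatching_engagements, fun u w ⟨⟨hu, hw⟩, _, prefers_w, prefers_u⟩ => ?_⟩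
  have has_proposed : (I.prefList u).idxOf (w : ℕ) < p u := by
    rcases settled u u.2 with ⟨w', hw'⟩ | hlen
    · have prefers := prefers_w ⟨w', lt_of_mem_prefList (h.fiance_mem hw')⟩
        (mem_engagements.2 hw')
      rw [← idxOf_prefList_val, ← idxOf_prefList_val] at prefers
      rw [h.proposals_eq hw']
      exact Nat.lt_succ_of_lt prefers
    · exact hlen ▸ List.idxOf_lt_length_of_mem (mem_prefList_val.2 hu)
  obtain ⟨v, hv, hle⟩ := h.le_suitor u u.2 w (mem_prefList_val.2 hu) has_proposed
    (mem_prefList_add_val.2 hw)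
  have prefers := prefers_u ⟨v, h.suitor_lt hv⟩ (mem_engagements.2 hv)
  rw [← idxOf_prefList_add_val, ← idxOf_prefList_add_val] at prefers
  exact prefers.not_ge hle

theorem card_engagements (h : Courtship I p m) : (I.engagements m).card = I.numEngaged m := by
  refine Finset.card_bij (fun q _ => (q.2 : ℕ)) (fun q hq => ?_)
    (fun q hq q' hq' heq => engagements_snd_inj hq hq' (Fin.ext heq)) fun w hw => ?_
  · simp [mem_engagements.1 hq]
  · rw [Finset.mem_filter, Finset.mem_range] at hw
    obtain ⟨u, hu⟩ := Nat.exists_eq_succ_of_ne_zero hw.2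
    exact ⟨(⟨u, h.suitor_lt hu⟩, ⟨w, hw.1⟩), mem_engagements.2 hu, rfl⟩

end Courtship

/-- The stage of deferred acceptance at which the agents `u ≤ i` have started to propose, and each
of them except `c` is engaged or has been rejected by everybody on the list. -/
structure Stage (I : GNSPM) (p m : ℕ → ℕ) (i c : ℕ) : Prop extends Courtship I p m where
  started_le : i ≤ I.n
  proposer_le : c ≤ i
  proposer_eq : i = I.n → c = I.n
  proposer_free : ∀ w, m w ≠ c + 1
  suitor_started : ∀ {u w}, m w = u + 1 → u ≤ i
  settled : ∀ u ≤ i, u < I.n → u ≠ c → (∃ w, m w = u + 1) ∨ p u = (I.prefList u).length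

namespace Stage

variable {p m : ℕ → ℕ} {i c w : ℕ}

theorem init (I : GNSPM) : Stage I 0 0 0 0 where
  toCourtship := .init I
  started_le := Nat.zero_le _
  proposer_le := le_rfl
  proposer_eq h := h
  proposer_free _ h := by simp at h
  suitor_started h := by simp at h
  settled u hu _ hne := absurd (Nat.le_zero.1 hu) hne

theorem resign (h : Stage I p m i c) (hi : i < I.n) (hp : p c = (I.prefList c).length) :
    Stage I p m (i + 1) (i + 1) where
  toCourtship := h.toCourtship
  started_le := hi
  proposer_le := le_rfl
  proposer_eq h := h
  proposer_free w hw := by have := h.suitor_started hw; omega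
  suitor_started hw := (h.suitor_started hw).trans (Nat.le_succ i)
  settled u hu hun hne := by
    by_cases huc : u = c
    · exact .inr (huc ▸ hp)
    · exact h.settled u (by omega) hun huc

theorem reject (h : Stage I p m i c) (hw : w ∈ I.prefList c) (hp : (I.prefList c).idxOf w = p c)
    (better : c ∈ I.prefList (I.n + w) →
      ∃ v, m w = v + 1 ∧ (I.prefList (I.n + w)).idxOf v ≤ (I.prefList (I.n + w)).idxOf c) :
    Stage I (Function.update p c (p c + 1)) m i c where
  toCourtship := h.toCourtship.reject h.proposer_free hw hp better
  started_le := h.started_le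
  proposer_le := h.proposer_le
  proposer_eq := h.proposer_eq
  proposer_free := h.proposer_free
  suitor_started := h.suitor_started
  settled u hu hun hne := by
    rw [Function.update_of_ne hne]
    exact h.settled u hu hun hne

theorem settled_engage (h : Stage I p m i c) {u : ℕ} (hu : u ≤ i) (hun : u < I.n)
    (hm : m w ≠ u + 1) :
    (∃ w', Function.update m w (c + 1) w' = u + 1) ∨
      Function.update p c (p c + 1) u = (I.prefList u).length := by
  by_cases huc : u = c
  · exact .inl ⟨w, by rw [Function.update_self, huc]⟩
  · rw [Function.update_of_ne huc]
    refine (h.settled u hu hun huc).imp (fun ⟨w', hw'⟩ => ⟨w', ?_⟩) id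
    have hne : w' ≠ w := fun hww => hm (hww ▸ hw')
    rw [Function.update_of_ne hne, hw']

theorem suitor_started_engage (h : Stage I p m i c) {u w' : ℕ}
    (hw' : Function.update m w (c + 1) w' = u + 1) : u ≤ i := by
  rw [Function.update_apply] at hw'
  split_ifs at hw'
  · exact Nat.succ.inj hw' ▸ h.proposer_le
  · exact h.suitor_started hw'

theorem accept (h : Stage I p m i c) (hi : i < I.n) (hw : w ∈ I.prefList c)
    (hp : (I.prefList c).idxOf w = p c) (hacc : c ∈ I.prefList (I.n + w)) (hm : m w = 0) :
    Stage I (Function.update p c (p c + 1)) (Function.update m w (c + 1)) (i + 1) (i + 1) where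
  toCourtship := h.toCourtship.engage (h.proposer_le.trans_lt hi) h.proposer_free hw hp hacc
    fun v hv => by omega
  started_le := hi
  proposer_le := le_rfl
  proposer_eq h := h
  proposer_free w' hw' := by have := h.suitor_started_engage hw'; omega
  suitor_started hw' := (h.suitor_started_engage hw').trans (Nat.le_succ i)
  settled u hu hun hne := h.settled_engage (by omega) hun (by omega)

theorem replace (h : Stage I p m i c) (hi : i < I.n) (hw : w ∈ I.prefList c)
    (hp : (I.prefList c).idxOf w = p c) (hacc : c ∈ I.prefList (I.n + w)) {v : ℕ}
    (hm : m w = v + 1)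
    (worse : (I.prefList (I.n + w)).idxOf c < (I.prefList (I.n + w)).idxOf v) :
    Stage I (Function.update p c (p c + 1)) (Function.update m w (c + 1)) i v where
  toCourtship := h.toCourtship.engage (h.proposer_le.trans_lt hi) h.proposer_free hw hp hacc
    fun v' hv' => by rwa [← Nat.succ.inj (hm.symm.trans hv')]
  started_le := h.started_le
  proposer_le := h.suitor_started hm
  proposer_eq h := by omega
  proposer_free w' hw' := by
    rw [Function.update_apply] at hw'
    split_ifs at hw' with hww
    · exact h.proposer_free w (hm.trans hw'.symm)
    · exact hww (h.fiance_unique hw' hm)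
  suitor_started := h.suitor_started_engage
  settled u hu hun hne := h.settled_engage hu hun (by omega)

theorem exists_stable (h : Stage I p m I.n c) :
    ∃ M, I.profile.IsStable M ∧ M.card = I.numEngaged m := by
  refine ⟨_, h.isStable_engagements fun u hu => h.settled u hu.le hu ?_, h.card_engagements⟩
  exact hu.trans_eq (h.proposer_eq rfl).symm |>.ne

end Stage

/-- The number of proposals and of agents still to come. -/
def remaining (I : GNSPM) (p : ℕ → ℕ) (i : ℕ) : ℕ :=
  (∑ u ∈ Finset.range I.n, ((I.prefList u).length - p u)) + (I.n - i)

theorem remaining_update_lt {p : ℕ → ℕ} {i i' u : ℕ} (hu : u < I.n)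
    (hp : p u < (I.prefList u).length) (hi : i ≤ i') :
    I.remaining (Function.update p u (p u + 1)) i' < I.remaining p i := by
  refine Nat.add_lt_add_of_lt_of_le (Finset.sum_lt_sum (fun v _ => ?_)
    ⟨u, Finset.mem_range.2 hu, ?_⟩) (by omega)
  · rw [Function.update_apply]
    split_ifs with h
    · subst h; omega
    · exact le_rfl
  · rw [Function.update_self]; omega

theorem offset_eq_sum (a : ℕ) :
    I.offset a = 2 + ∑ a' ∈ Finset.range a, ((I.prefList a').length + 1) := by
  induction a with
  | zero => rfl
  | succ a ih => rw [offset_succ, Finset.sum_range_succ, ih]; omega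

theorem remaining_zero_lt : I.remaining 0 0 < I.size := by
  have hle := (I.wordsBefore_isPrefix (show I.n ≤ 2 * I.n by omega)).length_le
  rw [← offset, ← offset, ← size_eq_offset, offset_eq_sum, Finset.sum_add_distrib] at hle
  simp only [Finset.sum_const, Finset.card_range, smul_eq_mul, mul_one] at hle
  simp only [remaining, Pi.zero_apply, Nat.sub_zero]
  omega

end GNSPM

theorem entryIn_eq_zero {l : List ℕ} {i : ℕ} : entryIn l i = 0 ↔ l.length ≤ i := by
  refine ⟨fun h => ?_, fun h => List.getD_eq_default _ _ (by simpa using h)⟩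
  by_contra hlt
  rw [entryIn, List.getD_eq_getElem _ _ (by simpa using hlt)] at h
  simp at h

theorem entryIn_of_lt {l : List ℕ} {i : ℕ} (h : i < l.length) : entryIn l i = l[i] + 1 := by
  rw [entryIn, List.getD_eq_getElem _ _ (by simpa using h)]
  simp

namespace WordRAM

open Var Table

variable {I : GNSPM} {s : State}

/-- The program that lets the next agent of `U` start to propose. -/
def startNext : Cmd := started ≔ started + 1 ;; proposer ≔ started

/-- One more than the next agent to whom the proposer proposes, and `0` if there is none. -/
def nextChoice : Expr := .cell entry (proposer * rowLength + .cell proposals proposer)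

/-- The rank of the agent `x` in the list of the candidate. -/
def rankOf (x : Expr) : Expr := .cell rank ((n + candidate) * rowLength + x)

/-- The program for the reaction of the candidate to the proposal. -/
def respond : Cmd :=
  .ite (rankOf proposer)
    (.ite (.cell fiance candidate)
      (.ite (.lt (rankOf proposer) (rankOf (.cell fiance candidate - 1)))
        (rival ≔ .cell fiance candidate - 1 ;;
          .setCell fiance candidate (proposer + 1) ;;
          proposer ≔ rival)
        .skip)
      (.setCell fiance candidate (proposer + 1) ;;
        engaged ≔ engaged + 1 ;;
        startNext))
    .skip

/-- The program for one proposal. -/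
def propose : Cmd :=
  .ite nextChoice
    (candidate ≔ nextChoice - 1 ;;
      .setCell proposals proposer (.cell proposals proposer + 1) ;;
      respond)
    startNext

/-- Deferred acceptance is in progress. -/
structure Courting (I : GNSPM) (s : State) : Prop where
  ready : Ready I s
  stage : I.Stage (s.cell proposals) (s.cell fiance) (s.get started) (s.get proposer)
  get_engaged : s.get engaged = I.numEngaged (s.cell fiance)
  cell_certificate : s.cell certificate = 0

/-- The proposer is about to propose to `w`. -/
structure Proposing (I : GNSPM) (w : ℕ) (s : State) : Prop extends Courting I s where
  started_lt : s.get started < I.n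
  mem_prefList : w ∈ I.prefList (s.get proposer)
  idxOf_eq : (I.prefList (s.get proposer)).idxOf w = s.cell proposals (s.get proposer)

/-- The state after the proposal to `w`, before the reaction of `w`. -/
def State.proposed (s : State) (w : ℕ) : State :=
  (s.set candidate w).setCell proposals (s.get proposer) (s.cell proposals (s.get proposer) + 1)

/-- After a proposal, deferred acceptance is still in progress, and has made progress. -/
def Advanced (I : GNSPM) (s s' : State) : Prop :=
  Courting I s' ∧ I.remaining (s'.cell proposals) (s'.get started) <
    I.remaining (s.cell proposals) (s.get started)

theorem Courting.startNext_wp (h : Courting I s) (hi : s.get started < I.n)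
    (hp : s.cell proposals (s.get proposer) = (I.prefList (s.get proposer)).length) :
    startNext.wp I.bound (Advanced I s) s := by
  have := I.le_size
  have value_le : s.get started + 1 ≤ I.bound := GNSPM.le_bound (by omega)
  have resigned : Courting I
      ((s.set started (s.get started + 1)).set proposer (s.get started + 1)) :=
    ⟨by simp [h.ready], by simpa using h.stage.resign hi hp,
      by simp [h.get_engaged], by simp [h.cell_certificate]⟩
  simpa [startNext, value_le, Advanced, GNSPM.remaining, resigned] using by omega

namespace Proposing

variable {w : ℕ}

theorem proposer_lt (h : Proposing I w s) : s.get proposer < I.n :=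
  h.stage.proposer_le.trans_lt h.started_lt

theorem lt (h : Proposing I w s) : w < I.n := GNSPM.lt_of_mem_prefList h.mem_prefList

theorem proposals_lt (h : Proposing I w s) :
    s.cell proposals (s.get proposer) < (I.prefList (s.get proposer)).length :=
  h.idxOf_eq ▸ List.idxOf_lt_length_of_mem h.mem_prefList

theorem advanced_reject (h : Proposing I w s)
    (better : s.get proposer ∈ I.prefList (I.n + w) →
      ∃ v, s.cell fiance w = v + 1 ∧
        (I.prefList (I.n + w)).idxOf v ≤ (I.prefList (I.n + w)).idxOf (s.get proposer)) :
    Advanced I s (s.proposed w) := by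
  refine ⟨⟨?_, ?_, ?_, ?_⟩, ?_⟩ <;> simp only [State.proposed]
  · simp [h.ready]
  · simpa using h.stage.reject h.mem_prefList h.idxOf_eq better
  · simp [h.get_engaged]
  · simp [h.cell_certificate]
  · simpa using GNSPM.remaining_update_lt h.proposer_lt h.proposals_lt le_rfl

theorem advanced_accept (h : Proposing I w s) (hacc : s.get proposer ∈ I.prefList (I.n + w))
    (hm : s.cell fiance w = 0) :
    Advanced I s (((((s.proposed w).setCell fiance w (s.get proposer + 1)).set engaged
      (s.get engaged + 1)).set started (s.get started + 1)).set proposer (s.get started + 1)) := by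
  refine ⟨⟨?_, ?_, ?_, ?_⟩, ?_⟩ <;> simp only [State.proposed]
  · simp [h.ready]
  · simpa using h.stage.accept h.started_lt h.mem_prefList h.idxOf_eq hacc hm
  · simp [h.get_engaged, GNSPM.numEngaged_update_of_eq_zero h.lt hm]
  · simp [h.cell_certificate]
  · simpa using GNSPM.remaining_update_lt h.proposer_lt h.proposals_lt (Nat.le_succ _)

theorem advanced_replace (h : Proposing I w s) (hacc : s.get proposer ∈ I.prefList (I.n + w))
    {v : ℕ} (hm : s.cell fiance w = v + 1)
    (worse : (I.prefList (I.n + w)).idxOf (s.get proposer) < (I.prefList (I.n + w)).idxOf v) :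
    Advanced I s ((((s.proposed w).set rival v).setCell fiance w (s.get proposer + 1)).set
      proposer v) := by
  refine ⟨⟨?_, ?_, ?_, ?_⟩, ?_⟩ <;> simp only [State.proposed]
  · simp [h.ready]
  · simpa using h.stage.replace h.started_lt h.mem_prefList h.idxOf_eq hacc hm worse
  · simp [h.get_engaged, GNSPM.numEngaged_update_of_ne_zero (show s.cell fiance w ≠ 0 by omega)]
  · simp [h.cell_certificate]
  · simpa using GNSPM.remaining_update_lt h.proposer_lt h.proposals_lt le_rfl

theorem rankOf_eval (h : Proposing I w s) {e : Expr} {x : ℕ} (hx : x ≤ I.n)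
    (he : e.eval (s.proposed w) = x) :
    (rankOf e).eval (s.proposed w) = rankIn (I.prefList (I.n + w)) x := by
  have := h.lt
  rw [← h.ready.rank_eq _ (by omega) _ hx, rankOf, Expr.eval_cell, Expr.eval_add, he]
  simp [State.proposed, h.ready.get_n, h.ready.get_rowLength]

theorem respond_wp (h : Proposing I w s) :
    respond.wp I.bound (Advanced I s) (s.proposed w) := by
  have := I.le_size
  have := h.lt
  have := h.started_lt
  have := h.proposer_lt
  have := I.numEngaged_le (s.cell fiance)
  have started_le : s.get started + 1 ≤ I.bound := GNSPM.le_bound (by omega)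
  have proposer_le : s.get proposer + 1 ≤ I.bound := GNSPM.le_bound (by omega)
  have engaged_le : s.get engaged + 1 ≤ I.bound :=
    GNSPM.le_bound (by rw [h.get_engaged]; omega)
  have get_candidate : (s.proposed w).get candidate = w := by simp [State.proposed]
  have get_proposer : (s.proposed w).get proposer = s.get proposer := by simp [State.proposed]
  have cell_fiance : (s.proposed w).cell fiance = s.cell fiance := by simp [State.proposed]
  have get_started : (s.proposed w).get started = s.get started := by simp [State.proposed]
  have get_engaged : (s.proposed w).get engaged = s.get engaged := by simp [State.proposed]
  have rank_proposer := h.rankOf_eval h.proposer_lt.le (e := proposer) get_proposer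
  by_cases hacc : s.get proposer ∈ I.prefList (I.n + w)
  · rw [rankIn, if_pos hacc] at rank_proposer
    rcases hm : s.cell fiance w with _ | v
    · have := h.advanced_accept hacc hm
      simp [respond, startNext, *]
    · have rank_rival := h.rankOf_eval (h.stage.suitor_lt hm).le
        (e := .cell fiance candidate - 1) (by simp [*])
      have v_le : v ≤ I.bound := GNSPM.le_bound (by have := h.stage.suitor_lt hm; omega)
      rw [rankIn, if_pos (h.stage.suitor_acceptable hm)] at rank_rival
      by_cases worse : (I.prefList (I.n + w)).idxOf (s.get proposer) <
          (I.prefList (I.n + w)).idxOf v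
      · have := h.advanced_replace hacc hm worse
        simp [respond, *]
      · have := h.advanced_reject fun _ => ⟨v, hm, not_lt.1 worse⟩
        simp [respond, *]
  · rw [rankIn, if_neg hacc] at rank_proposer
    have := h.advanced_reject fun hacc' => absurd hacc' hacc
    simpa [respond, rank_proposer] using this

end Proposing

theorem Courting.propose_runs (h : Courting I s) (hi : s.get started < I.n) :
    Runs I.bound propose s propose.cost (Advanced I s) := by
  have := h.stage.proposer_le
  have := I.le_size
  have eval_choice : nextChoice.eval s =
      entryIn (I.prefList (s.get proposer)) (s.cell proposals (s.get proposer)) := by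
    rw [← h.ready.entry_eq (s.get proposer) (by omega) _
      ((h.stage.proposals_le _ (by omega)).trans (I.length_prefList_le _))]
    simp [nextChoice, h.ready.get_rowLength]
  refine .of_wp ?_
  rcases lt_or_ge (s.cell proposals (s.get proposer)) (I.prefList (s.get proposer)).length
    with hlt | hge
  · set w := (I.prefList (s.get proposer))[s.cell proposals (s.get proposer)] with hw
    rw [entryIn_of_lt hlt, ← hw] at eval_choice
    have proposing : Proposing I w s :=
      ⟨h, hi, List.getElem_mem hlt, (I.nodup_prefList _).idxOf_getElem _ hlt⟩
    have := proposing.lt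
    have w_le : w ≤ I.bound := GNSPM.le_bound (by omega)
    have proposals_le : s.cell proposals (s.get proposer) + 1 ≤ I.bound :=
      GNSPM.le_bound (by have := I.length_prefList_le (s.get proposer); omega)
    simpa [propose, eval_choice, w_le, proposals_le, State.proposed] using proposing.respond_wp
  · rw [entryIn_eq_zero.2 hge] at eval_choice
    simpa [propose, eval_choice] using
      h.startNext_wp hi (hge.antisymm' (h.stage.proposals_le _ (by omega)))

/-- The program that computes the size of a stable matching by deferred acceptance. -/
def deferredAcceptance : Cmd :=
  (started ≔ 0 ;; proposer ≔ 0 ;; engaged ≔ 0) ;; .loop (.lt started n) propose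

theorem deferredAcceptance_runs (h : Ready I s) (hproposals : s.cell proposals = 0)
    (hfiance : s.cell fiance = 0) (hcertificate : s.cell certificate = 0) :
    Runs I.bound deferredAcceptance s (deferredAcceptance.cost * I.size) fun s' =>
      Ready I s' ∧ s'.cell certificate = 0 ∧
        ∃ M, I.profile.IsStable M ∧ M.card = s'.get engaged := by
  set s₀ := ((s.set started 0).set proposer 0).set engaged 0 with hs₀
  have courting : Courting I s₀ := by
    refine ⟨by simp [hs₀, h], ?_, ?_, by simp [hs₀, hcertificate]⟩
    · simpa [hs₀, hproposals, hfiance] using GNSPM.Stage.init I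
    · simp [hs₀, hfiance, GNSPM.numEngaged]
  have loop_runs : Runs I.bound (.loop (.lt started n) propose) s₀
      (((Expr.lt started n).cost + 1 + propose.cost) * I.size) fun s' =>
      Ready I s' ∧ s'.cell certificate = 0 ∧
        ∃ M, I.profile.IsStable M ∧ M.card = s'.get engaged := by
    refine (Runs.loop (Courting I) (fun s => I.remaining (s.cell proposals) (s.get started))
      (fun s hs he => hs.propose_runs (by simpa [hs.ready.get_n] using he)) courting).mono ?_ ?_
    · gcongr
      simpa [hs₀, hproposals] using I.remaining_zero_lt
    · rintro s' ⟨hs, he⟩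
      have : s'.get started = I.n :=
        hs.stage.started_le.antisymm (by simpa [hs.ready.get_n] using he)
      rw [hs.get_engaged]
      exact ⟨hs.ready, hs.cell_certificate, (this ▸ hs.stage).exists_stable⟩
  have one_le := I.le_size
  refine (Runs.of_wp_seq (by simpa using loop_runs)).mono ?_ fun _ => id
  simp only [deferredAcceptance, Cmd.cost]
  nlinarith

end WordRAM

/-! ### The kernel -/

namespace Profile

variable {n : ℕ} {P Q : Profile n}

theorem toFinset_eq_of_listSwapDist_ne_top {l l' : List (Fin n)} (h : listSwapDist l l' ≠ ⊤) :
    l.toFinset = l'.toFinset :=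
  not_imp_comm.1 (fun hne => if_neg hne) h

theorem listSwapDist_le_sq {l l' : List (Fin n)} (h : listSwapDist l l' ≠ ⊤) :
    listSwapDist l l' ≤ (n ^ 2 : ℕ) := by
  rw [listSwapDist, if_pos (toFinset_eq_of_listSwapDist_ne_top h)]
  refine Nat.cast_le.2 ((Finset.card_filter_le _ _).trans ?_)
  have : l.toFinset.card ≤ n := by simpa using Finset.card_le_univ l.toFinset
  rw [Finset.card_product, sq]
  gcongr

theorem swapDist_ne_top_iff :
    P.swapDist Q ≠ ⊤ ↔ (∀ u, listSwapDist (P.prefU u) (Q.prefU u) ≠ ⊤) ∧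
      ∀ w, listSwapDist (P.prefW w) (Q.prefW w) ≠ ⊤ := by
  simp [swapDist, not_or]

theorem acceptable_iff_of_swapDist_ne_top (h : P.swapDist Q ≠ ⊤) (u w : Fin n) :
    Q.Acceptable u w ↔ P.Acceptable u w := by
  obtain ⟨hU, hW⟩ := swapDist_ne_top_iff.1 h
  rw [Acceptable, Acceptable, ← List.mem_toFinset, ← List.mem_toFinset (a := u),
    ← toFinset_eq_of_listSwapDist_ne_top (hU u), ← toFinset_eq_of_listSwapDist_ne_top (hW w),
    List.mem_toFinset, List.mem_toFinset]

theorem swapDist_le_of_ne_top (h : P.swapDist Q ≠ ⊤) : P.swapDist Q ≤ (2 * n ^ 3 : ℕ) := by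
  obtain ⟨hU, hW⟩ := swapDist_ne_top_iff.1 h
  calc P.swapDist Q
      ≤ Finset.card (Finset.univ : Finset (Fin n)) • ((n ^ 2 : ℕ) : ℕ∞) +
          Finset.card (Finset.univ : Finset (Fin n)) • ((n ^ 2 : ℕ) : ℕ∞) :=
        add_le_add (Finset.sum_le_card_nsmul _ _ _ fun u _ => listSwapDist_le_sq (hU u))
          (Finset.sum_le_card_nsmul _ _ _ fun w _ => listSwapDist_le_sq (hW w))
    _ = (2 * n ^ 3 : ℕ) := by
        rw [Finset.card_fin, ← two_nsmul, ← Nat.cast_smul_eq_nsmul ℕ∞]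
        push_cast
        ring

theorem IsMatching.eq_of_fst_eq {M : Finset (Fin n × Fin n)} (hM : P.IsMatching M)
    {p q : Fin n × Fin n} (hp : p ∈ M) (hq : q ∈ M) (h : p.1 = q.1) : p = q :=
  not_imp_comm.1 (fun hne => (hM.2 p hp q hq hne).1) (not_not.2 h)

theorem IsMatching.eq_of_snd_eq {M : Finset (Fin n × Fin n)} (hM : P.IsMatching M)
    {p q : Fin n × Fin n} (hp : p ∈ M) (hq : q ∈ M) (h : p.2 = q.2) : p = q :=
  not_imp_comm.1 (fun hne => (hM.2 p hp q hq hne).2) (not_not.2 h)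

theorem IsMatching.exists_equiv {M : Finset (Fin n × Fin n)} (hM : P.IsMatching M)
    (hp : IsPerfect M) : ∃ e : Fin n ≃ Fin n, ∀ u w, (u, w) ∈ M ↔ e u = w := by
  choose p hp_mem using fun u => hp (.inl u)
  have mem_iff : ∀ u w, (u, w) ∈ M ↔ p u = w := fun u w =>
    ⟨fun h => congrArg Prod.snd (hM.eq_of_fst_eq (hp_mem u) h rfl), fun h => h ▸ hp_mem u⟩
  have injective : Function.Injective p := fun u v huv =>
    congrArg Prod.fst (hM.eq_of_snd_eq (hp_mem u) (hp_mem v) huv)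
  exact ⟨.ofBijective p (Finite.injective_iff_bijective.1 injective), mem_iff⟩

theorem IsStable.mem_image_of_acceptable {M : Finset (Fin n × Fin n)} (hM : P.IsStable M)
    {u w : Fin n} (h : P.Acceptable u w) : u ∈ M.image Prod.fst ∨ w ∈ M.image Prod.snd := by
  by_contra! hunmatched
  obtain ⟨hu, hw⟩ := hunmatched
  exact hM.2 u w ⟨h, fun hmem => hu (Finset.mem_image_of_mem _ hmem),
    fun w' hmem => absurd (Finset.mem_image_of_mem Prod.fst hmem) hu,
    fun u' hmem => absurd (Finset.mem_image_of_mem Prod.snd hmem) hw⟩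

theorem IsStable.le_two_mul_card {M M' : Finset (Fin n × Fin n)} {d : ℕ} (hM : P.IsStable M)
    (hM' : P.GloballyNearlyStable d M') (hperfect : IsPerfect M') : n ≤ 2 * M.card := by
  obtain ⟨Q, hQ, hstable⟩ := hM'
  obtain ⟨e, mem_iff⟩ := hstable.1.exists_equiv hperfect
  have acceptable (u : Fin n) : P.Acceptable u (e u) :=
    (acceptable_iff_of_swapDist_ne_top (ne_top_of_le_ne_top (ENat.natCast_ne_top d) hQ) _ _).1 <|
      hstable.1.1 (u, e u) ((mem_iff _ _).2 rfl)
  have cover : Finset.univ ⊆ M.image Prod.fst ∪ (M.image Prod.snd).map e.symm.toEmbedding := by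
    intro u _
    simpa only [Finset.mem_union, Finset.mem_map_equiv, Equiv.symm_symm] using
      hM.mem_image_of_acceptable (acceptable u)
  calc n = Finset.card (Finset.univ : Finset (Fin n)) := (Finset.card_fin n).symm
    _ ≤ (M.image Prod.fst).card + ((M.image Prod.snd).map e.symm.toEmbedding).card :=
        (Finset.card_le_card cover).trans (Finset.card_union_le _ _)
    _ ≤ M.card + M.card := by
        rw [Finset.card_map]
        exact add_le_add Finset.card_image_le Finset.card_image_le
    _ = 2 * M.card := (two_mul _).symm

theorem IsStable.two_mul_card_le_numMatched {M : Finset (Fin n × Fin n)} (hM : P.IsStable M) :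
    2 * M.card ≤ P.numMatched := by
  let agentOf : M ⊕ M → {x // P.InitiallyMatched x} :=
    Sum.elim (fun p => ⟨.inl p.1.1, M, hM, p.1.2, p.2⟩) fun p => ⟨.inr p.1.2, M, hM, p.1.1, p.2⟩
  have agentOf_injective : Function.Injective agentOf := by
    rintro (⟨p, hp⟩ | ⟨p, hp⟩) (⟨q, hq⟩ | ⟨q, hq⟩) h <;> replace h := congrArg Subtype.val h
    · simpa using hM.1.eq_of_fst_eq hp hq (Sum.inl.inj h)
    · cases h
    · cases h
    · simpa using hM.1.eq_of_snd_eq hp hq (Sum.inr.inj h)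
  have := Nat.card_le_card_of_injective agentOf agentOf_injective
  rwa [Nat.card_eq_fintype_card, Fintype.card_sum, Fintype.card_coe, ← two_mul] at this

end Profile

namespace GNSPM

/-- A no-instance of constant size: one agent on either side, and empty lists. -/
def trivialNo : GNSPM where
  n := 1
  profile := ⟨fun _ => [], fun _ => [], fun _ => List.nodup_nil, fun _ => List.nodup_nil⟩
  d := 0

theorem encode_trivialNo : trivialNo.encode = [1, 0, 0, 0] := rfl

theorem not_isYes_trivialNo : ¬ trivialNo.IsYes := by
  rintro ⟨M, ⟨Q, hQ, hstable⟩, hperfect⟩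
  obtain ⟨w, hw⟩ := hperfect (Sum.inl (0 : Fin 1))
  have acceptable := hstable.1.1 _ hw
  rw [Profile.acceptable_iff_of_swapDist_ne_top
    (ne_top_of_le_ne_top (ENat.natCast_ne_top _) hQ)] at acceptable
  exact List.not_mem_nil acceptable.1

/-- The instance with the distance bound capped at `2 * n ^ 3`, which bounds the finite swap
distances. -/
def cap (I : GNSPM) : GNSPM where
  n := I.n
  profile := I.profile
  d := min I.d (2 * I.n ^ 3)

variable {I : GNSPM}

theorem isYes_cap : I.cap.IsYes ↔ I.IsYes := by
  have le_cap_iff (Q : Profile I.n) :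
      I.profile.swapDist Q ≤ I.cap.d ↔ I.profile.swapDist Q ≤ I.d := by
    change _ ≤ ((min I.d (2 * I.n ^ 3) : ℕ) : ℕ∞) ↔ _
    rw [Nat.mono_cast.map_min, le_min_iff, and_iff_left_iff_imp]
    exact fun h => Profile.swapDist_le_of_ne_top (ne_top_of_le_ne_top (ENat.natCast_ne_top _) h)
  exact exists_congr fun M => and_congr_left' (exists_congr fun Q => and_congr_left' (le_cap_iff Q))

theorem encode_cap_getElem {i : ℕ} (hi : i < I.cap.encode.length) :
    I.cap.encode[i] = if i = 1 then min I.d (2 * I.n ^ 3) else I.word i := by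
  match i, hi with
  | 0, _ => rfl
  | 1, _ => rfl
  | i + 2, hi => exact (List.getD_eq_getElem I.cap.encode 0 hi).symm

theorem two_mul_cube_le_bound : 2 * I.n ^ 3 ≤ I.bound := by
  refine le_bound_of_le_pow (k := 3) (by norm_num) ?_
  have : (2 * I.n) ^ 3 ≤ (I.size + I.d) ^ 3 :=
    Nat.pow_le_pow_left (by have := I.le_size; omega) 3
  rw [mul_pow] at this
  omega

/-- Instance `J` is equivalent to instance `I`, and its size is bounded in terms of `I.nm`. -/
structure IsKernel (J I : GNSPM) : Prop where
  isYes_iff : J.IsYes ↔ I.IsYes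
  two_mul_n_le : 2 * J.n ≤ max (2 * I.nm) 2
  d_le : J.d ≤ 2 * J.n ^ 3

theorem not_isYes_of_card_lt {M : Finset (Fin I.n × Fin I.n)} (hM : I.profile.IsStable M)
    (h : 2 * M.card < I.n) : ¬ I.IsYes := fun ⟨_, hM', hperfect⟩ =>
  h.not_ge (hM.le_two_mul_card hM' hperfect)

theorem n_le_nm {M : Finset (Fin I.n × Fin I.n)} (hM : I.profile.IsStable M)
    (h : I.n ≤ 2 * M.card) : I.n ≤ I.nm := h.trans hM.two_mul_card_le_numMatched

theorem isKernel_trivialNo (h : ¬ I.IsYes) : trivialNo.IsKernel I where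
  isYes_iff := iff_of_false not_isYes_trivialNo h
  two_mul_n_le := le_max_right _ _
  d_le := Nat.zero_le _

theorem isKernel_cap (h : I.n ≤ I.nm) : I.cap.IsKernel I where
  isYes_iff := isYes_cap
  two_mul_n_le := le_max_of_le_left (Nat.mul_le_mul_left 2 h)
  d_le := min_le_right _ _

end GNSPM

namespace WordRAM

open Var Table

variable {I : GNSPM} {s : State}

/-- The program that reads the input and computes the size of a stable matching. -/
def matchingSize : Cmd := readInput ;; deferredAcceptance

theorem matchingSize_runs :
    Runs I.bound matchingSize (.init I.encode) (matchingSize.cost * I.size) fun s =>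
      Ready I s ∧ s.cell certificate = 0 ∧
        ∃ M, I.profile.IsStable M ∧ M.card = s.get engaged := by
  refine (readInput_runs.seq fun s ⟨ready, cell_eq⟩ => deferredAcceptance_runs ready
    (cell_eq _ ?_ ?_) (cell_eq _ ?_ ?_) (cell_eq _ ?_ ?_)).mono (add_mul ..).ge fun _ => id
  all_goals decide

@[simp] theorem wp_store {b : ℕ} {a e : Expr} {Q : State → Prop} :
    (Cmd.store a e).wp b Q s ↔
      e.eval s ≤ b ∧ Q { s with mem := Function.update s.mem (a.eval s) (e.eval s) } := Iff.rfl

/-- `2 * n ^ 3`, a bound for the finite swap distances. -/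
def maxDistance : Expr := 2 * (n * (n * n))

/-- The program that replaces the input by a kernel. -/
def writeKernel : Cmd :=
  answer ≔ 0 ;;
  .ite (.lt (2 * engaged) n)
    (.store 0 1 ;; .store 1 0 ;; .store 2 0 ;; .store 3 0)
    (.ite (.lt maxDistance (.mem 1)) (.store 1 maxDistance) .skip)

/-- The program that computes a kernel. -/
def kernelize : Cmd := matchingSize ;; writeKernel

theorem writeKernel_wp_of_lt (h : Ready I s) (hno : ¬ I.IsYes) (hlt : 2 * s.get engaged < I.n) :
    writeKernel.wp I.bound (fun s' => ∃ J : GNSPM, s'.Outputs J.encode ∧ J.IsKernel I) s := by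
  have one_le := one_le_two.trans (GNSPM.two_le_bound (I := I))
  simp only [writeKernel, wp_seq, wp_set, wp_ite, wp_store, Expr.eval_ofNat]
  simp only [Expr.eval_lt, Expr.eval_mul, Expr.eval_ofNat, Expr.eval_var, State.get_set, h.get_n,
    reduceCtorEq, if_false, hlt, if_true]
  refine ⟨Nat.zero_le _, fun _ => ⟨one_le, Nat.zero_le _, Nat.zero_le _, Nat.zero_le _,
    GNSPM.trivialNo, ?_, GNSPM.isKernel_trivialNo hno⟩, fun h => absurd h (by simp)⟩
  rw [GNSPM.encode_trivialNo]
  intro i hi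
  match i, hi with
  | 0, _ | 1, _ | 2, _ | 3, _ => rfl

theorem writeKernel_wp_of_le (h : Ready I s) (hnm : I.n ≤ I.nm) (hle : I.n ≤ 2 * s.get engaged) :
    writeKernel.wp I.bound (fun s' => ∃ J : GNSPM, s'.Outputs J.encode ∧ J.IsKernel I) s := by
  have word_eq (i : ℕ) (hi : i < I.cap.encode.length) : s.mem i = I.word i :=
    h.mem_eq i (lt_of_lt_of_le hi I.size_le)
  have eval_maxDistance : maxDistance.eval (s.set answer 0) = 2 * I.n ^ 3 := by
    simp [maxDistance, h.get_n, pow_succ, mul_assoc]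
  have outputs {m : ℕ → ℕ} (hm : ∀ i, m i = if i = 1 then min I.d (2 * I.n ^ 3) else s.mem i) :
      State.Outputs { s.set answer 0 with mem := m } I.cap.encode := by
    intro i hi
    rw [GNSPM.encode_cap_getElem, ← word_eq i hi, ← hm]
    exact congrArg m (Nat.zero_add i)
  have isKernel := GNSPM.isKernel_cap hnm
  simp only [writeKernel, wp_seq, wp_set, wp_ite, wp_store, wp_skip, Expr.eval_ofNat]
  simp only [Expr.eval_lt, Expr.eval_mul, Expr.eval_ofNat, Expr.eval_var, Expr.eval_mem,
    State.get_set, h.get_n, reduceCtorEq, if_false, hle.not_gt, State.mem_set, h.mem_one,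
    eval_maxDistance]
  refine ⟨Nat.zero_le _, fun h => absurd rfl h, fun _ => ⟨fun hlt => ?_, fun hge => ?_⟩⟩
  · have hlt : 2 * I.n ^ 3 < I.d := by simpa using hlt
    refine ⟨GNSPM.two_mul_cube_le_bound, I.cap, outputs fun i => ?_, isKernel⟩
    rw [min_eq_right hlt.le, Function.update_apply]
  · have hge : I.d ≤ 2 * I.n ^ 3 := by simpa using hge
    refine ⟨I.cap, outputs fun i => ?_, isKernel⟩
    rw [min_eq_left hge, ← h.mem_one]
    split_ifs with hi
    · rw [hi]
    · rfl

theorem writeKernel_wp (h : Ready I s) {M : Finset (Fin I.n × Fin I.n)}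
    (hM : I.profile.IsStable M) (hcard : M.card = s.get engaged) :
    writeKernel.wp I.bound (fun s' => ∃ J : GNSPM, s'.Outputs J.encode ∧ J.IsKernel I) s := by
  rcases lt_or_ge (2 * M.card) I.n with hlt | hle
  · exact writeKernel_wp_of_lt h (GNSPM.not_isYes_of_card_lt hM hlt) (hcard ▸ hlt)
  · exact writeKernel_wp_of_le h (GNSPM.n_le_nm hM hle) (hcard ▸ hle)

theorem kernelize_runs :
    Runs I.bound kernelize (.init I.encode) (kernelize.cost * I.size) fun s =>
      ∃ J : GNSPM, s.Outputs J.encode ∧ J.IsKernel I := by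
  have := I.le_size
  refine (matchingSize_runs.seq (T₂ := writeKernel.cost) fun s ⟨ready, _, M, hM, hcard⟩ =>
    .of_wp (writeKernel_wp ready hM hcard)).mono ?_ fun _ => id
  simp only [kernelize, Cmd.cost, add_mul]
  gcongr
  exact Nat.le_mul_of_pos_right _ (by omega)

end WordRAM

/-! ### Certificates -/

section StableSort

variable {α : Type*} [DecidableEq α] {r : α → ℕ} {l : List α} {x y : α}

theorem idxOf_insertionSort_lt_of_lt {β : Type*} [LinearOrder β] {κ : α → β} (hx : x ∈ l)
    (hy : y ∈ l) (h : κ x < κ y) :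
    (l.insertionSort fun x y => κ x ≤ κ y).idxOf x <
      (l.insertionSort fun x y => κ x ≤ κ y).idxOf y := by
  have : Std.Total fun x y : α => κ x ≤ κ y := ⟨fun _ _ => le_total _ _⟩
  have : IsTrans α fun x y => κ x ≤ κ y := ⟨fun _ _ _ => le_trans⟩
  have sorted := List.pairwise_insertionSort (fun x y => κ x ≤ κ y) l
  rw [← List.mem_insertionSort fun x y => κ x ≤ κ y] at hx hy
  by_contra hle
  rcases (not_lt.1 hle).lt_or_eq with hlt | heq
  · have := List.pairwise_iff_getElem.1 sorted _ _ (List.idxOf_lt_length_iff.2 hy)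
      (List.idxOf_lt_length_iff.2 hx) hlt
    simp only [List.getElem_idxOf] at this
    exact this.not_gt h
  · exact h.ne' (congrArg κ ((List.idxOf_inj hy).1 heq))

/-- The list sorted by the keys `r`; members with equal keys keep their order. -/
def stableSort (r : α → ℕ) (l : List α) : List α :=
  l.insertionSort fun x y => toLex (r x, l.idxOf x) ≤ toLex (r y, l.idxOf y)

theorem stableSort_perm (r : α → ℕ) (l : List α) : (stableSort r l).Perm l :=
  List.perm_insertionSort _ l

theorem idxOf_stableSort_lt_of_lt (hx : x ∈ l) (hy : y ∈ l) (h : r x < r y) :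
    (stableSort r l).idxOf x < (stableSort r l).idxOf y :=
  idxOf_insertionSort_lt_of_lt (κ := fun x => toLex (r x, l.idxOf x)) hx hy
    (Prod.Lex.toLex_lt_toLex.2 (.inl h))

theorem idxOf_stableSort_lt_iff (hx : x ∈ l) (hy : y ∈ l) (hxy : l.idxOf x < l.idxOf y) :
    (stableSort r l).idxOf y < (stableSort r l).idxOf x ↔ r y < r x := by
  refine ⟨fun h => not_le.1 fun hle => h.not_gt ?_, idxOf_stableSort_lt_of_lt hy hx⟩
  exact idxOf_insertionSort_lt_of_lt (κ := fun x => toLex (r x, l.idxOf x)) hx hy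
    (Prod.Lex.toLex_lt_toLex.2 (hle.lt_or_eq.imp_right fun heq => ⟨heq, hxy⟩))

end StableSort

namespace GNSPM

/-- The lists of `a` in `I` and in the profile described by the table `T` order `x` and `y`
differently, and `x` comes first in the former. Here and below, `T a x` is the new rank of `x` for
the agent `a` if `x < n`, and the partner of `a` if `x = n`. -/
def Inverts (I : GNSPM) (T : ℕ → ℕ → ℕ) (a x y : ℕ) : Prop :=
  x ∈ I.prefList a ∧ y ∈ I.prefList a ∧ (I.prefList a).idxOf x < (I.prefList a).idxOf y ∧
    T a y < T a x

/-- The pair `{u, w}` blocks the matching described by the table `T`. -/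
def BlockedBy (I : GNSPM) (T : ℕ → ℕ → ℕ) (u w : ℕ) : Prop :=
  w ∈ I.prefList u ∧ u ∈ I.prefList (I.n + w) ∧ w ≠ T u I.n ∧ T u w ≤ T u (T u I.n) ∧
    T (I.n + w) u ≤ T (I.n + w) (T (I.n + w) I.n)

open Classical in
/-- The swap distance of the lists of the agent `a` in `I` and in the profile described by `T`. -/
noncomputable def inversions (I : GNSPM) (T : ℕ → ℕ → ℕ) (a : ℕ) : ℕ :=
  ∑ x ∈ Finset.range I.n, ∑ y ∈ Finset.range I.n, if I.Inverts T a x y then 1 else 0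

/-- The table `T` describes a profile within the permitted distance and a perfect matching that is
stable in it. -/
structure IsCertificate (I : GNSPM) (T : ℕ → ℕ → ℕ) : Prop where
  acceptable : ∀ a < 2 * I.n, T a I.n ∈ I.prefList a
  involutive : ∀ u < I.n, T (I.n + T u I.n) I.n = u
  not_blockedBy : ∀ u < I.n, ∀ w < I.n, ¬I.BlockedBy T u w
  inversions_le : ∑ a ∈ Finset.range (2 * I.n), I.inversions T a ≤ I.d

variable {I : GNSPM} {T : ℕ → ℕ → ℕ}

theorem listSwapDist_eq_inversions {a : ℕ} {l l' : List (Fin I.n)}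
    (hl : I.prefList a = l.map Fin.val) (hset : l.toFinset = l'.toFinset)
    (hord : ∀ x ∈ l, ∀ y ∈ l, l.idxOf x < l.idxOf y →
      (l'.idxOf y < l'.idxOf x ↔ T a y < T a x)) :
    Profile.listSwapDist l l' = (I.inversions T a : ℕ∞) := by
  classical
  rw [Profile.listSwapDist, if_pos hset, inversions, Finset.sum_range]
  simp only [Finset.sum_range]
  rw [← Finset.sum_product', ← Finset.card_filter]
  congr 2
  ext ⟨x, y⟩
  simp only [Finset.mem_filter, Finset.mem_product, List.mem_toFinset, Finset.mem_univ, true_and,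
    Inverts, hl, idxOf_map_of_injective Fin.val_injective,
    List.mem_map_of_injective Fin.val_injective, and_assoc]
  exact and_congr_right fun hx => and_congr_right fun hy => and_congr_right (hord x hx y hy)

theorem swapDist_eq_sum_inversions {Q : Profile I.n}
    (hU : ∀ u, Profile.listSwapDist (I.profile.prefU u) (Q.prefU u) = (I.inversions T u : ℕ∞))
    (hW : ∀ w, Profile.listSwapDist (I.profile.prefW w) (Q.prefW w) =
      (I.inversions T (I.n + w) : ℕ∞)) :
    I.profile.swapDist Q = ((∑ a ∈ Finset.range (2 * I.n), I.inversions T a : ℕ) : ℕ∞) := by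
  rw [Profile.swapDist, two_mul, Finset.sum_range_add, Finset.sum_range, Finset.sum_range]
  push_cast
  simp only [hU, hW]

/-- The profile described by the table `T`. -/
def sortedProfile (I : GNSPM) (T : ℕ → ℕ → ℕ) : Profile I.n where
  prefU u := stableSort (fun w => T u w) (I.profile.prefU u)
  prefW w := stableSort (fun u => T (I.n + w) u) (I.profile.prefW w)
  nodupU u := (stableSort_perm _ _).nodup_iff.2 (I.profile.nodupU u)
  nodupW w := (stableSort_perm _ _).nodup_iff.2 (I.profile.nodupW w)

theorem swapDist_sortedProfile :
    I.profile.swapDist (I.sortedProfile T) =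
      ((∑ a ∈ Finset.range (2 * I.n), I.inversions T a : ℕ) : ℕ∞) :=
  swapDist_eq_sum_inversions
    (fun u => listSwapDist_eq_inversions (I.prefList_val u)
      (List.toFinset_eq_of_perm _ _ (stableSort_perm _ _).symm)
      fun _ hx _ hy => idxOf_stableSort_lt_iff hx hy)
    (fun w => listSwapDist_eq_inversions (I.prefList_add_val w)
      (List.toFinset_eq_of_perm _ _ (stableSort_perm _ _).symm)
      fun _ hx _ hy => idxOf_stableSort_lt_iff hx hy)

namespace IsCertificate

/-- The partner of an agent of `U` in the matching described by a certificate. -/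
def partner (h : I.IsCertificate T) (u : Fin I.n) : Fin I.n :=
  ⟨T u I.n, lt_of_mem_prefList (h.acceptable u (by omega))⟩

theorem partner_partner (h : I.IsCertificate T) (u : Fin I.n) :
    T (I.n + h.partner u) I.n = u := h.involutive u u.2

theorem partner_injective (h : I.IsCertificate T) : Function.Injective h.partner := fun u v huv =>
  Fin.ext (by rw [← h.partner_partner u, ← h.partner_partner v, huv])

theorem partner_surjective (h : I.IsCertificate T) : Function.Surjective h.partner :=
  Finite.surjective_of_injective h.partner_injective

theorem acceptable_partner (h : I.IsCertificate T) (u : Fin I.n) :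
    I.profile.Acceptable u (h.partner u) := by
  refine ⟨mem_prefList_val.1 (h.acceptable u (by omega)), mem_prefList_add_val.1 ?_⟩
  have := h.acceptable (I.n + h.partner u) (by omega)
  rwa [h.partner_partner] at this

/-- The matching described by a certificate. -/
def matching (h : I.IsCertificate T) : Finset (Fin I.n × Fin I.n) :=
  Finset.univ.image fun u => (u, h.partner u)

theorem mem_matching (h : I.IsCertificate T) {u w : Fin I.n} :
    (u, w) ∈ h.matching ↔ h.partner u = w := by
  simp [matching]

theorem isMatching_matching (h : I.IsCertificate T) :
    (I.sortedProfile T).IsMatching h.matching := by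
  refine ⟨?_, ?_⟩
  · rintro ⟨u, w⟩ huw
    obtain rfl := h.mem_matching.1 huw
    exact ⟨(stableSort_perm _ _).mem_iff.2 (h.acceptable_partner u).1,
      (stableSort_perm _ _).mem_iff.2 (h.acceptable_partner u).2⟩
  · rintro ⟨u, w⟩ huw ⟨u', w'⟩ huw' hne
    obtain rfl := h.mem_matching.1 huw
    obtain rfl := h.mem_matching.1 huw'
    have hne : u ≠ u' := fun heq => hne (by rw [heq])
    exact ⟨hne, h.partner_injective.ne hne⟩

theorem isStable_matching (h : I.IsCertificate T) : (I.sortedProfile T).IsStable h.matching := by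
  refine ⟨h.isMatching_matching, fun u w hblocks => ?_⟩
  obtain ⟨⟨hw, hu⟩, hnot, better_u, better_w⟩ := hblocks
  replace hw := (stableSort_perm _ _).mem_iff.1 hw
  replace hu := (stableSort_perm _ _).mem_iff.1 hu
  obtain ⟨v, rfl⟩ := h.partner_surjective w
  refine h.not_blockedBy u u.2 (h.partner v) (Fin.is_lt _) ⟨mem_prefList_val.2 hw,
    mem_prefList_add_val.2 hu, fun heq => hnot (h.mem_matching.2 (Fin.ext heq.symm)), ?_, ?_⟩
  · exact not_lt.1 fun hlt => (better_u _ (h.mem_matching.2 rfl)).not_gt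
      (idxOf_stableSort_lt_of_lt (h.acceptable_partner u).1 hw hlt)
  · rw [h.partner_partner]
    exact not_lt.1 fun hlt => (better_w _ (h.mem_matching.2 rfl)).not_gt
      (idxOf_stableSort_lt_of_lt (h.acceptable_partner v).2 hu hlt)

theorem isYes (h : I.IsCertificate T) : I.IsYes := by
  refine ⟨h.matching, ⟨I.sortedProfile T, ?_, h.isStable_matching⟩, ?_⟩
  · rw [swapDist_sortedProfile]
    exact Nat.cast_le.2 h.inversions_le
  · rintro (u | w)
    · exact ⟨h.partner u, h.mem_matching.2 rfl⟩
    · obtain ⟨u, hu⟩ := h.partner_surjective w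
      exact ⟨u, h.mem_matching.2 hu⟩

theorem congr {T' : ℕ → ℕ → ℕ} (h : I.IsCertificate T)
    (hT : ∀ a < 2 * I.n, ∀ x ≤ I.n, T' a x = T a x) : I.IsCertificate T' := by
  have partner_lt : ∀ a < 2 * I.n, T a I.n < I.n := fun a ha =>
    lt_of_mem_prefList (h.acceptable a ha)
  have eq_partner : ∀ a < 2 * I.n, T' a I.n = T a I.n := fun a ha => hT a ha _ le_rfl
  refine ⟨fun a ha => ?_, fun u hu => ?_, fun u hu w hw => ?_, ?_⟩
  · rw [eq_partner a ha]
    exact h.acceptable a ha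
  · have := partner_lt u (by omega)
    rw [eq_partner u (by omega), eq_partner _ (by omega), h.involutive u hu]
  · have hu' : u < 2 * I.n := by omega
    have hw' : I.n + w < 2 * I.n := by omega
    rw [BlockedBy, eq_partner u hu', eq_partner _ hw', hT u hu' w hw.le, hT _ hw' u hu.le,
      hT u hu' _ (partner_lt u hu').le, hT _ hw' _ (partner_lt _ hw').le]
    exact h.not_blockedBy u hu w hw
  · refine (Finset.sum_congr rfl fun a ha => ?_).trans_le h.inversions_le
    rw [inversions, inversions]
    refine Finset.sum_congr rfl fun x hx => Finset.sum_congr rfl fun y hy => ?_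
    rw [Finset.mem_range] at ha hx hy
    have : I.Inverts T' a x y ↔ I.Inverts T a x y := by
      simp only [Inverts, hT a ha x hx.le, hT a ha y hy.le]
    rw [propext this]

end IsCertificate

end GNSPM

namespace Profile

variable {n : ℕ} {P Q : Profile n} {M : Finset (Fin n × Fin n)}

theorem idxOf_lt_of_nodup {l : List (Fin n)} (hl : l.Nodup) (x : Fin n) : l.idxOf x < n := by
  by_cases hx : x ∈ l
  · simpa using (List.idxOf_lt_length_iff.2 hx).trans_le hl.length_le_card
  · simpa [List.idxOf_of_notMem hx] using (hl.cons hx).length_le_card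

/-- The table of the ranks in the profile `Q` and of the partners in a perfect matching, given by
the bijection `e`. -/
def table (Q : Profile n) (e : Fin n ≃ Fin n) (a x : ℕ) : ℕ :=
  if hu : a < n then if hx : x < n then Q.rkU ⟨a, hu⟩ ⟨x, hx⟩ else e ⟨a, hu⟩
  else if hw : a - n < n then if hx : x < n then Q.rkW ⟨a - n, hw⟩ ⟨x, hx⟩ else e.symm ⟨a - n, hw⟩
  else 0

section Table

variable (Q) (e : Fin n ≃ Fin n) (u w : Fin n)

theorem table_lt {a : ℕ} (ha : a < 2 * n) (x : ℕ) : Q.table e a x < n := by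
  unfold table
  split_ifs
  · exact idxOf_lt_of_nodup (Q.nodupU _) _
  · exact Fin.is_lt _
  · exact idxOf_lt_of_nodup (Q.nodupW _) _
  · exact Fin.is_lt _
  · omega

@[simp] theorem table_val_val : Q.table e u w = Q.rkU u w := by simp [table]

@[simp] theorem table_val_self : Q.table e u n = e u := by simp [table]

@[simp] theorem table_add_val : Q.table e (n + w) u = Q.rkW w u := by simp [table]

@[simp] theorem table_add_self : Q.table e (n + w) n = e.symm w := by simp [table]

end Table

end Profile

namespace GNSPM

variable {I : GNSPM} {Q : Profile I.n} {M : Finset (Fin I.n × Fin I.n)} {e : Fin I.n ≃ Fin I.n}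

theorem not_blockedBy_table (hst : Q.IsStable M) (he : ∀ u w, (u, w) ∈ M ↔ e u = w)
    (hQ : ∀ u w, Q.Acceptable u w ↔ I.profile.Acceptable u w) (u w : Fin I.n) :
    ¬I.BlockedBy (Q.table e) u w := by
  rintro ⟨hw, hu, hne, le_u, le_w⟩
  have hacc : Q.Acceptable u w :=
    (hQ u w).2 ⟨mem_prefList_val.1 hw, mem_prefList_add_val.1 hu⟩
  simp only [Profile.table_val_self, Profile.table_val_val, Profile.table_add_self,
    Profile.table_add_val, ne_eq, Fin.val_inj] at hne le_u le_w
  refine hst.2 u w ⟨hacc, fun h => hne ((he u w).1 h).symm, fun w' hw' => ?_, fun u' hu' => ?_⟩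
  · obtain rfl := (he u w').1 hw'
    exact le_u.lt_of_ne fun heq => hne ((List.idxOf_inj hacc.1).1 heq)
  · obtain rfl := e.symm_apply_eq.2 ((he u' w).1 hu').symm
    exact le_w.lt_of_ne fun heq => hne (e.symm_apply_eq.1 ((List.idxOf_inj hacc.2).1 heq).symm)

theorem swapDist_eq_sum_inversions_table (h : I.profile.swapDist Q ≠ ⊤) :
    I.profile.swapDist Q =
      ((∑ a ∈ Finset.range (2 * I.n), I.inversions (Q.table e) a : ℕ) : ℕ∞) := by
  obtain ⟨hU, hW⟩ := Profile.swapDist_ne_top_iff.1 h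
  refine swapDist_eq_sum_inversions (fun u => ?_) fun w => ?_
  · refine listSwapDist_eq_inversions (I.prefList_val u)
      (Profile.toFinset_eq_of_listSwapDist_ne_top (hU u)) fun x _ y _ _ => ?_
    simp only [Profile.table_val_val, Profile.rkU]
  · refine listSwapDist_eq_inversions (I.prefList_add_val w)
      (Profile.toFinset_eq_of_listSwapDist_ne_top (hW w)) fun x _ y _ _ => ?_
    simp only [Profile.table_add_val, Profile.rkW]

theorem isCertificate_table (hd : I.profile.swapDist Q ≤ I.d) (hst : Q.IsStable M)
    (he : ∀ u w, (u, w) ∈ M ↔ e u = w) : I.IsCertificate (Q.table e) := by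
  have hd_top := ne_top_of_le_ne_top (ENat.natCast_ne_top I.d) hd
  have hQ := Profile.acceptable_iff_of_swapDist_ne_top hd_top
  have acceptable_e : ∀ u, I.profile.Acceptable u (e u) := fun u =>
    (hQ u (e u)).1 (hst.1.1 _ ((he u _).2 rfl))
  refine ⟨fun a ha => ?_, fun u hu => ?_, fun u hu w hw => ?_, ?_⟩
  · rcases lt_or_ge a I.n with hu | hw
    · lift a to Fin I.n using hu
      rw [Profile.table_val_self, mem_prefList_val]
      exact (acceptable_e a).1
    · obtain ⟨w, rfl⟩ := Nat.exists_eq_add_of_le hw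
      lift w to Fin I.n using by omega
      rw [Profile.table_add_self, mem_prefList_add_val]
      simpa using (acceptable_e (e.symm w)).2
  · lift u to Fin I.n using hu
    simp
  · exact not_blockedBy_table hst he hQ ⟨u, hu⟩ ⟨w, hw⟩
  · rw [← Nat.cast_le (α := ℕ∞), ← swapDist_eq_sum_inversions_table hd_top]
    exact hd

theorem isYes_iff_exists_isCertificate :
    I.IsYes ↔ ∃ T, (∀ a < 2 * I.n, ∀ x, T a x < I.n) ∧ I.IsCertificate T := by
  refine ⟨?_, fun ⟨_, _, h⟩ => h.isYes⟩
  rintro ⟨M, ⟨Q, hd, hst⟩, hp⟩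
  obtain ⟨e, he⟩ := hst.1.exists_equiv hp
  exact ⟨Q.table e, fun _ => Q.table_lt e, isCertificate_table hd hst he⟩

variable {T : ℕ → ℕ → ℕ}

/-- The table `T` gives `a` an unacceptable partner, or pairs it with somebody else's partner, or
`a` and `x` block the matching. -/
def Defect (I : GNSPM) (T : ℕ → ℕ → ℕ) (a x : ℕ) : Prop :=
  T a I.n ∉ I.prefList a ∨ a < I.n ∧ (T (I.n + T a I.n) I.n ≠ a ∨ I.BlockedBy T a x)

theorem isCertificate_iff : I.IsCertificate T ↔
    (∀ a < 2 * I.n, ∀ x < I.n, ¬I.Defect T a x) ∧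
      ∑ a ∈ Finset.range (2 * I.n), I.inversions T a ≤ I.d := by
  constructor
  · refine fun h => ⟨fun a ha x hx => ?_, h.inversions_le⟩
    rintro (hdefect | ⟨hu, hdefect | hdefect⟩)
    exacts [hdefect (h.acceptable a ha), hdefect (h.involutive a hu),
      h.not_blockedBy a hu x hx hdefect]
  · rintro ⟨no_defect, hd⟩
    exact ⟨fun a ha => by_contra fun h => no_defect a ha 0 (by omega) (.inl h),
      fun u hu => by_contra fun h => no_defect u (by omega) 0 (by omega) (.inr ⟨hu, .inl h⟩),
      fun u hu w hw h => no_defect u (by omega) w hw (.inr ⟨hu, .inr h⟩), hd⟩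

open Classical in
/-- The contribution of a triple to the cost of a table; a single defect is prohibitive. -/
noncomputable def tripleCost (I : GNSPM) (T : ℕ → ℕ → ℕ) (a x y : ℕ) : ℕ :=
  (if I.Inverts T a x y then 1 else 0) + (I.d + 1) * (if I.Defect T a x then 1 else 0)

/-- The cost of a table, which exceeds `d` unless the table is a certificate. -/
noncomputable def tableCost (I : GNSPM) (T : ℕ → ℕ → ℕ) : ℕ :=
  ∑ a ∈ Finset.range (2 * I.n), ∑ x ∈ Finset.range I.n, ∑ y ∈ Finset.range I.n,
    I.tripleCost T a x y

theorem tableCost_le_iff : I.tableCost T ≤ I.d ↔ I.IsCertificate T := by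
  classical
  have add_le_iff : ∀ s k : ℕ, s + (I.d + 1) * k ≤ I.d ↔ k = 0 ∧ s ≤ I.d := fun s k => by
    rcases k.eq_zero_or_pos with rfl | hk
    · simp
    · have := Nat.le_mul_of_pos_right (I.d + 1) hk
      omega
  simp only [tableCost, tripleCost, Finset.sum_add_distrib, ← Finset.mul_sum, add_le_iff,
    isCertificate_iff, Finset.sum_eq_zero_iff, Finset.mem_range, inversions, ite_eq_right_iff,
    one_ne_zero, imp_false]
  exact and_congr_left fun _ =>
    ⟨fun h a ha x hx => h a ha x hx x hx, fun h a ha x hx _ _ => h a ha x hx⟩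

end GNSPM

/-! ### Digits -/

/-- The digit of `k` at position `i` in base `n`. -/
def digit (n k i : ℕ) : ℕ := k / n ^ i % n

theorem digit_lt {n : ℕ} (hn : 0 < n) (k i : ℕ) : digit n k i < n := Nat.mod_lt _ hn

@[simp] theorem digit_zero (n : ℕ) : digit n 0 = 0 := by
  funext i
  simp [digit]

theorem exists_digit_eq {n L : ℕ} {f : ℕ → ℕ} (hf : ∀ i < L, f i < n) :
    ∃ k < n ^ L, ∀ i < L, digit n k i = f i := by
  let g : Fin L → Fin n := fun i => ⟨f i, hf i i.2⟩
  refine ⟨finFunctionFinEquiv g, Fin.is_lt _, fun i hi => ?_⟩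
  exact congrArg Fin.val (congrFun (finFunctionFinEquiv.symm_apply_apply g) ⟨i, hi⟩)

section Successor

variable {n k j : ℕ}

theorem pow_succ_dvd_succ_iff (hn : 0 < n) (h : n ^ j ∣ k + 1) :
    n ^ (j + 1) ∣ k + 1 ↔ digit n k j + 1 = n := by
  have hdiv : (k + 1) / n ^ j = n * (k / n ^ j / n) + (digit n k j + 1) := by
    rw [Nat.succ_div_of_dvd h, digit, ← add_assoc, Nat.div_add_mod]
  rw [pow_succ, ← Nat.dvd_div_iff_mul_dvd h, hdiv, Nat.dvd_add_right (Nat.dvd_mul_right ..)]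
  exact ⟨fun h => (Nat.succ_le_of_lt (digit_lt hn k j)).antisymm (Nat.le_of_dvd (Nat.succ_pos _) h),
    fun h => by rw [h]⟩

theorem digit_succ (hn : 0 < n) (h : n ^ j ∣ k + 1) (hj : digit n k j + 1 ≠ n) :
    digit n (k + 1) =
      Function.update (fun i => if i < j then 0 else digit n k i) j (digit n k j + 1) := by
  funext i
  rcases lt_trichotomy i j with hi | rfl | hi
  · have : n ∣ (k + 1) / n ^ i :=
      Nat.dvd_div_of_mul_dvd (pow_succ n i ▸ (pow_dvd_pow n hi).trans h)
    simp [hi, hi.ne, digit, Nat.mod_eq_zero_of_dvd this]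
  · have hlt : k / n ^ i % n + 1 < n := lt_of_le_of_ne (digit_lt hn k i) hj
    rw [Function.update_self, digit, digit, Nat.succ_div_of_dvd h, ← Nat.mod_add_mod,
      Nat.mod_eq_of_lt hlt]
  · have not_dvd : ¬n ^ i ∣ k + 1 := fun hd =>
      hj ((pow_succ_dvd_succ_iff hn h).1 ((pow_dvd_pow n hi).trans hd))
    simp [hi.ne', hi.not_gt, digit, Nat.succ_div_of_not_dvd not_dvd]

end Successor

namespace GNSPM

variable {I : GNSPM}

/-- The number of entries of a table. -/
def tableSize (I : GNSPM) : ℕ := 2 * I.n * (I.n + 1)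

theorem n_pos_of_lt_tableSize {j : ℕ} (h : j < I.tableSize) : 0 < I.n :=
  Nat.pos_of_ne_zero fun hn => by simp [tableSize, hn] at h

/-- The table whose entries, row by row, are the digits of `k` in base `n`. -/
def digitTable (I : GNSPM) (k a x : ℕ) : ℕ := digit I.n k (a * (I.n + 1) + x)

theorem exists_isCertificate_digitTable (h : I.IsYes) :
    ∃ k < I.n ^ I.tableSize, I.IsCertificate (I.digitTable k) := by
  obtain ⟨T, T_lt, hT⟩ := isYes_iff_exists_isCertificate.1 h
  have row_lt : ∀ i < I.tableSize, i / (I.n + 1) < 2 * I.n := fun i hi =>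
    (Nat.div_lt_iff_lt_mul I.n.succ_pos).2 hi
  obtain ⟨k, hk, hdigit⟩ := exists_digit_eq (f := fun i => T (i / (I.n + 1)) (i % (I.n + 1)))
    fun i hi => T_lt _ (row_lt i hi) _
  refine ⟨k, hk, hT.congr fun a ha x hx => ?_⟩
  have hx : x < I.n + 1 := Nat.lt_succ_of_le hx
  have hi : a * (I.n + 1) + x < I.tableSize := by rw [tableSize]; nlinarith
  rw [digitTable, hdigit _ hi, Nat.mul_comm, Nat.mul_add_div I.n.succ_pos, Nat.div_eq_of_lt hx,
    add_zero, Nat.mul_add_mod, Nat.mod_eq_of_lt hx]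

end GNSPM

/-! ### Computing the cost of a table -/

section RankIn

variable {l : List ℕ} {x y : ℕ}

theorem rankIn_pos_iff : 0 < rankIn l x ↔ x ∈ l := by
  unfold rankIn
  split_ifs with hx <;> simp [hx]

theorem rankIn_pos_and_lt_iff :
    0 < rankIn l x ∧ rankIn l x < rankIn l y ↔ x ∈ l ∧ y ∈ l ∧ l.idxOf x < l.idxOf y := by
  unfold rankIn
  split_ifs <;> simp [*]

end RankIn

namespace GNSPM

variable {I : GNSPM}

theorem tripleCost_le (T : ℕ → ℕ → ℕ) (a x y : ℕ) : I.tripleCost T a x y ≤ I.d + 2 := by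
  unfold tripleCost
  split_ifs <;> omega

theorem tableCost_le_bound (T : ℕ → ℕ → ℕ) : I.tableCost T ≤ I.bound := by
  have hsize := I.le_size
  calc I.tableCost T
      ≤ ∑ _a ∈ Finset.range (2 * I.n), ∑ _x ∈ Finset.range I.n, ∑ _y ∈ Finset.range I.n,
          (I.d + 2) := by
        unfold tableCost
        gcongr
        exact tripleCost_le ..
    _ = 2 * I.n * (I.n * (I.n * (I.d + 2))) := by simp
    _ ≤ (I.size + I.d) * ((I.size + I.d) * ((I.size + I.d) * (I.size + I.d))) := by
        exact Nat.mul_le_mul (by omega) (Nat.mul_le_mul (by omega)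
          (Nat.mul_le_mul (by omega) (by omega)))
    _ = I.bound := by rw [bound]; ring

end GNSPM

namespace WordRAM

open Var Table

namespace Expr

variable {s : State} {e f : Expr} {p q : Prop}

/-- In the state `s`, the value of the expression tells whether `p` holds. -/
def Decides (e : Expr) (s : State) (p : Prop) : Prop := (p → e.eval s = 1) ∧ (¬p → e.eval s = 0)

/-- Conjunction of expressions with values `0` and `1`. -/
def and (e f : Expr) : Expr := e * f

/-- Disjunction of expressions with values `0` and `1`. -/
def or (e f : Expr) : Expr := .lt 0 (e + f)

/-- Negation of an expression with values `0` and `1`. -/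
def not (e : Expr) : Expr := .eq e 0

namespace Decides

theorem eval_eq [Decidable p] (h : e.Decides s p) : e.eval s = if p then 1 else 0 := by
  split_ifs with hp
  exacts [h.1 hp, h.2 hp]

theorem congr (h : e.Decides s p) (hpq : p ↔ q) : e.Decides s q := propext hpq ▸ h

theorem lt : (lt e f).Decides s (e.eval s < f.eval s) := by
  constructor <;> intro h <;> simp [h]

theorem eq : (eq e f).Decides s (e.eval s = f.eval s) := by
  constructor <;> intro h <;> simp [h]

theorem and (he : e.Decides s p) (hf : p → f.Decides s q) : (e.and f).Decides s (p ∧ q) := by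
  refine ⟨fun h => ?_, fun h => ?_⟩
  · simp [Expr.and, he.1 h.1, (hf h.1).1 h.2]
  · by_cases hp : p
    · simp [Expr.and, (hf hp).2 fun hq => h ⟨hp, hq⟩]
    · simp [Expr.and, he.2 hp]

theorem or (he : e.Decides s p) (hf : f.Decides s q) : (e.or f).Decides s (p ∨ q) := by
  refine ⟨?_, fun h => ?_⟩
  · rintro (h | h)
    · simp [Expr.or, he.1 h]
    · simp [Expr.or, hf.1 h]
  · rw [not_or] at h
    simp [Expr.or, he.2 h.1, hf.2 h.2]

theorem not (h : e.Decides s p) : e.not.Decides s ¬p :=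
  ⟨fun hp => by simp [Expr.not, h.2 hp], fun hp => by simp [Expr.not, h.1 (not_not.1 hp)]⟩

end Decides

end Expr

/-- The rank of `x` in the list of `a`, as read from the input. -/
def inputRank (a x : Expr) : Expr := .cell rank (a * rowLength + x)

/-- The entry of the current table in row `a` and column `x`. -/
def tableEntry (a x : Expr) : Expr := .cell certificate (a * rowLength + x)

/-- The test for `GNSPM.Inverts` at `owner`, `first`, and `second`. -/
def inverts : Expr :=
  .and (.and (.lt 0 (inputRank owner first))
      (.lt (inputRank owner first) (inputRank owner second)))
    (.lt (tableEntry owner second) (tableEntry owner first))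

/-- The test for `GNSPM.BlockedBy` at `owner` and `first`. -/
def blocked : Expr :=
  .and (.lt 0 (inputRank owner first)) <| .and (.lt 0 (inputRank (n + first) owner)) <|
    .and (.not (.eq first (tableEntry owner n))) <|
      .and (.not (.lt (tableEntry owner (tableEntry owner n)) (tableEntry owner first)))
        (.not (.lt (tableEntry (n + first) (tableEntry (n + first) n))
          (tableEntry (n + first) owner)))

/-- The test for `GNSPM.Defect` at `owner` and `first`. -/
def defect : Expr :=
  .or (.not (.lt 0 (inputRank owner (tableEntry owner n))))
    (.and (.lt owner n)
      (.or (.not (.eq (tableEntry (n + tableEntry owner n) n) owner)) blocked))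

/-- `GNSPM.tripleCost` at `owner`, `first`, and `second`; the cell `1` of the memory holds `d`. -/
def tripleCost : Expr := inverts + (.mem 1 + 1) * defect

/-- The lists have been read, the current table is `GNSPM.digitTable I k`, and the search has not
yet been decided. -/
structure Searching (I : GNSPM) (k : ℕ) (s : State) : Prop where
  ready : Ready I s
  cell_certificate : s.cell certificate = digit I.n k
  get_answer : s.get answer = 0
  get_exhausted : s.get exhausted = 0

namespace Searching

variable {I : GNSPM} {k i j : ℕ} {s : State} {a x : Expr}

theorem set (h : Searching I k s) {v : Var} {x : ℕ}
    (hv : v ∉ [n, rowLength, base, answer, exhausted]) : Searching I k (s.set v x) := by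
  simp only [List.mem_cons, List.not_mem_nil, or_false, not_or, ← ne_eq] at hv
  obtain ⟨hn, hr, hb, ha, he⟩ := hv
  exact ⟨(Tabulates.set_iff hn.symm hr.symm hb.symm).2 h.ready,
    by rw [State.cell_set hb.symm, h.cell_certificate],
    by rw [State.get_set, if_neg ha.symm, h.get_answer],
    by rw [State.get_set, if_neg he.symm, h.get_exhausted]⟩

theorem eval_inputRank (h : Searching I k s) (ha : a.eval s = i) (hi : i < 2 * I.n)
    (hx : x.eval s = j) (hj : j ≤ I.n) : (inputRank a x).eval s = rankIn (I.prefList i) j := by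
  simp only [inputRank, Expr.eval_cell, Expr.eval_add, Expr.eval_mul, Expr.eval_var,
    h.ready.get_rowLength, ha, hx]
  exact h.ready.rank_eq i hi j hj

theorem eval_tableEntry (h : Searching I k s) (ha : a.eval s = i) (hx : x.eval s = j) :
    (tableEntry a x).eval s = I.digitTable k i j := by
  simp only [tableEntry, Expr.eval_cell, Expr.eval_add, Expr.eval_mul, Expr.eval_var,
    h.ready.get_rowLength, h.cell_certificate, GNSPM.digitTable, ha, hx]

theorem eval_partner (h : Searching I k s) (ha : a.eval s = i) :
    (tableEntry a n).eval s = I.digitTable k i I.n := h.eval_tableEntry ha h.ready.get_n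

theorem decides_mem (h : Searching I k s) (ha : a.eval s = i) (hi : i < 2 * I.n)
    (hx : x.eval s = j) (hj : j ≤ I.n) :
    (Expr.lt 0 (inputRank a x)).Decides s (j ∈ I.prefList i) :=
  Expr.Decides.lt.congr <| by rw [h.eval_inputRank ha hi hx hj, ← rankIn_pos_iff, Expr.eval_ofNat]

theorem decides_inverts (h : Searching I k s) (ha : s.get owner < 2 * I.n)
    (hx : s.get first ≤ I.n) (hy : s.get second ≤ I.n) :
    inverts.Decides s (I.Inverts (I.digitTable k) (s.get owner) (s.get first) (s.get second)) := by
  have rank_first := h.eval_inputRank (Expr.eval_var owner) ha (Expr.eval_var first) hx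
  have rank_second := h.eval_inputRank (Expr.eval_var owner) ha (Expr.eval_var second) hy
  refine ((Expr.Decides.lt.and fun _ => .lt).and fun _ => .lt).congr ?_
  rw [rank_first, rank_second, h.eval_tableEntry rfl rfl, h.eval_tableEntry rfl rfl,
    Expr.eval_ofNat, rankIn_pos_and_lt_iff, and_assoc, and_assoc]
  rfl

theorem decides_blocked (h : Searching I k s) (ha : s.get owner < I.n) (hx : s.get first < I.n) :
    blocked.Decides s (I.BlockedBy (I.digitTable k) (s.get owner) (s.get first)) := by
  have hu : (owner : Expr).eval s = s.get owner := rfl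
  have hw : (first : Expr).eval s = s.get first := rfl
  have hrow : (n + first : Expr).eval s = I.n + s.get first := by simp [h.ready.get_n]
  refine ((h.decides_mem hu (by omega) hw hx.le).and fun _ =>
    (h.decides_mem hrow (by omega) hu ha.le).and fun _ =>
      (Expr.Decides.not .eq).and fun _ => (Expr.Decides.not .lt).and fun _ => .not .lt).congr ?_
  rw [h.eval_tableEntry hu (h.eval_partner hu), h.eval_tableEntry hrow (h.eval_partner hrow),
    h.eval_tableEntry hu hw, h.eval_tableEntry hrow hu, h.eval_partner hu, not_lt, not_lt]
  rfl

theorem decides_defect (h : Searching I k s) (ha : s.get owner < 2 * I.n)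
    (hx : s.get first < I.n) :
    defect.Decides s (I.Defect (I.digitTable k) (s.get owner) (s.get first)) := by
  have howner : (owner : Expr).eval s = s.get owner := rfl
  have hpartner := h.eval_partner howner
  have hrow : (n + tableEntry owner n : Expr).eval s =
      I.n + I.digitTable k (s.get owner) I.n := by
    rw [Expr.eval_add, Expr.eval_var, h.ready.get_n, hpartner]
  refine ((h.decides_mem howner ha hpartner (digit_lt (by omega) _ _).le).not.or
    (Expr.Decides.lt.and fun hlt => .or (.not .eq)
      (h.decides_blocked (by simpa [h.ready.get_n] using hlt) hx))).congr ?_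
  rw [h.eval_partner hrow, Expr.eval_var, Expr.eval_var, h.ready.get_n]
  rfl

theorem eval_tripleCost (h : Searching I k s) (ha : s.get owner < 2 * I.n)
    (hx : s.get first < I.n) (hy : s.get second < I.n) :
    tripleCost.eval s =
      I.tripleCost (I.digitTable k) (s.get owner) (s.get first) (s.get second) := by
  classical
  simp only [tripleCost, GNSPM.tripleCost, Expr.eval_add, Expr.eval_mul, Expr.eval_mem,
    Expr.eval_ofNat, h.ready.mem_one, (h.decides_inverts ha hx.le hy.le).eval_eq,
    (h.decides_defect ha hx).eval_eq]

end Searching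

theorem Runs.accumulate {b M N : ℕ} {v : Var} {e : Expr} {c : Cmd} {s : State} {P : State → Prop}
    {f : ℕ → ℕ} (hv : v ≠ total) (hM : 1 ≤ M) (hN : N ≤ b)
    (set : ∀ s x, P s → P (s.set v x)) (eval_eq : ∀ s, P s → e.eval s = N)
    (body : ∀ j < N, ∀ s, P s → s.get v = j → s.get total + f j ≤ b →
      Runs b c s (c.cost * M) fun s' =>
        P s' ∧ s'.get v = j ∧ s'.get total = s.get total + f j)
    (hs : P s) (hsum : s.get total + ∑ i ∈ Finset.range N, f i ≤ b) :
    Runs b (.forUpTo v e c) s ((Cmd.forUpTo v e c).cost * (M * (N + 1))) fun s' =>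
      P s' ∧ s'.get total = s.get total + ∑ i ∈ Finset.range N, f i := by
  refine (Runs.forUpTo (fun j s' => P s' ∧ s'.get v = j ∧
    s'.get total = s.get total + ∑ i ∈ Finset.range j, f i) hM hN (fun _ _ h => h.2.1)
    (fun _ s h => eval_eq s h.1) ⟨set _ _ hs, by simp, by simp [hv.symm]⟩
    fun j hj s' ⟨hs', hget, htotal⟩ => ?_).mono le_rfl fun s' h => ⟨h.1, h.2.2⟩
  have hle : ∑ i ∈ Finset.range (j + 1), f i ≤ ∑ i ∈ Finset.range N, f i :=
    Finset.sum_le_sum_of_subset (Finset.range_subset_range.2 hj)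
  rw [Finset.sum_range_succ] at hle
  refine (body j hj s' hs' hget (by omega)).mono le_rfl fun s'' ⟨hs'', hget', htotal'⟩ =>
    ⟨hget', set _ _ hs'', by simp, ?_⟩
  rw [State.get_set, if_neg hv.symm, htotal', htotal, Finset.sum_range_succ, add_assoc]

/-- The program that adds the costs of all triples with the current `owner` and `first`. -/
def addPairCost : Cmd := .forUpTo second n (total ≔ total + tripleCost)

/-- The program that adds the costs of all triples with the current `owner`. -/
def addOwnerCost : Cmd := .forUpTo first n addPairCost

/-- The program that computes the cost of the current table. -/
def evaluate : Cmd := total ≔ 0 ;; .forUpTo owner (2 * n) addOwnerCost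

theorem addPairCost_runs (h : Searching I k s) (ha : s.get owner < 2 * I.n)
    (hx : s.get first < I.n)
    (hle : s.get total + ∑ y ∈ Finset.range I.n,
      I.tripleCost (I.digitTable k) (s.get owner) (s.get first) y ≤ I.bound) :
    Runs I.bound addPairCost s (addPairCost.cost * (1 * (I.n + 1))) fun s' =>
      (Searching I k s' ∧ s'.get owner = s.get owner ∧ s'.get first = s.get first) ∧
        s'.get total = s.get total + ∑ y ∈ Finset.range I.n,
          I.tripleCost (I.digitTable k) (s.get owner) (s.get first) y := by
  have hsize := I.le_size
  refine Runs.accumulate (P := fun s' => Searching I k s' ∧ s'.get owner = s.get owner ∧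
    s'.get first = s.get first) (by decide) le_rfl (GNSPM.le_bound (by omega))
    (fun s' y h => ⟨h.1.set (by decide), by simpa using h.2⟩) (fun s' h => h.1.ready.get_n)
    (fun y hy s' ⟨hs', howner, hfirst⟩ hsecond htotal => ?_) ⟨h, rfl, rfl⟩ hle
  have eval_eq := hs'.eval_tripleCost (howner ▸ ha) (hfirst ▸ hx) (hsecond ▸ hy)
  rw [howner, hfirst, hsecond] at eval_eq
  rw [mul_one]
  refine .of_wp (wp_set.2 ⟨?_, ?_⟩)
  · rwa [Expr.eval_add, eval_eq, Expr.eval_var]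
  · exact ⟨⟨hs'.set (by decide), by simpa using howner, by simpa using hfirst⟩,
      by simpa using hsecond, by simp [eval_eq]⟩

theorem addOwnerCost_runs (h : Searching I k s) (ha : s.get owner < 2 * I.n)
    (hle : s.get total + ∑ x ∈ Finset.range I.n, ∑ y ∈ Finset.range I.n,
      I.tripleCost (I.digitTable k) (s.get owner) x y ≤ I.bound) :
    Runs I.bound addOwnerCost s (addOwnerCost.cost * (1 * (I.n + 1) * (I.n + 1))) fun s' =>
      (Searching I k s' ∧ s'.get owner = s.get owner) ∧
        s'.get total = s.get total + ∑ x ∈ Finset.range I.n, ∑ y ∈ Finset.range I.n,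
          I.tripleCost (I.digitTable k) (s.get owner) x y := by
  have hsize := I.le_size
  refine Runs.accumulate (P := fun s' => Searching I k s' ∧ s'.get owner = s.get owner)
    (by decide) (by simp) (GNSPM.le_bound (by omega))
    (fun s' x h => ⟨h.1.set (by decide), by simpa using h.2⟩) (fun s' h => h.1.ready.get_n)
    (fun x hx s' ⟨hs', howner⟩ hfirst htotal => ?_) ⟨h, rfl⟩ hle
  rw [← howner, ← hfirst] at htotal ⊢
  exact (addPairCost_runs hs' (howner ▸ ha) (hfirst ▸ hx) htotal).mono le_rfl
    fun s'' ⟨⟨hs'', howner', hfirst'⟩, htotal'⟩ => ⟨⟨hs'', howner'⟩, hfirst', htotal'⟩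

/-- The time for evaluating a table, up to a constant factor. -/
def tableTime (m : ℕ) : ℕ := (m + 1) * (m + 1) * (2 * m + 1)

theorem evaluate_runs (h : Searching I k s) :
    Runs I.bound evaluate s (evaluate.cost * tableTime I.n) fun s' =>
      Searching I k s' ∧ s'.get total = I.tableCost (I.digitTable k) := by
  have hsize := I.le_size
  have sum_runs : Runs I.bound (.forUpTo owner (2 * n) addOwnerCost) (s.set total 0)
      ((Cmd.forUpTo owner (2 * n) addOwnerCost).cost *
        (1 * (I.n + 1) * (I.n + 1) * (2 * I.n + 1))) fun s' =>
      Searching I k s' ∧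
        s'.get total = (s.set total 0).get total + I.tableCost (I.digitTable k) := by
    refine Runs.accumulate (by decide) (by simp) (GNSPM.le_bound (by omega))
      (fun s' a h => h.set (by decide)) (fun s' h => by simp [h.ready.get_n])
      (fun a ha s' hs' howner htotal => ?_) (h.set (by decide))
      (by simpa [GNSPM.tableCost] using I.tableCost_le_bound (I.digitTable k))
    subst howner
    exact (addOwnerCost_runs hs' ha htotal).mono le_rfl fun s'' ⟨⟨hs'', howner⟩, htotal'⟩ =>
      ⟨hs'', howner, htotal'⟩
  refine (Runs.of_wp_seq (wp_set.2 ⟨Nat.zero_le _, sum_runs⟩)).mono ?_ fun s' h =>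
    ⟨h.1, by simpa using h.2⟩
  simp only [evaluate, tableTime, Cmd.cost, add_mul _ _ (_ * _ * _), one_mul]
  gcongr
  exact Nat.le_mul_of_pos_right _ (by positivity)

end WordRAM

/-! ### Exhaustive search -/

namespace WordRAM

open Var Table

/-- The expression for `GNSPM.tableSize`. -/
def tableSize : Expr := 2 * n * rowLength

/-- The test whether there is a digit at the current place and it is the largest possible one. -/
def carries : Expr := .and (.lt place tableSize) (.eq (.cell certificate place + 1) n)

/-- The program that increments the digit at the current place or, if there is no such digit, sets
`exhausted`. -/
def increment : Cmd :=
  .ite (.lt place tableSize)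
    (.setCell certificate place (.cell certificate place + 1))
    (exhausted ≔ 1)

/-- The program that replaces the table of the digits of `k` by that of the digits of `k + 1`, or
sets `exhausted` if `k` has the largest possible digit at each place. -/
def advance : Cmd :=
  place ≔ 0 ;;
  .loop carries (.setCell certificate place 0 ;; place ≔ place + 1) ;;
  increment

variable {I : GNSPM} {k j : ℕ} {s : State}

/-- The search has moved on from the table of the digits of `k` to that of the digits of `k + 1`,
or there is no further table. -/
def AtNextTable (I : GNSPM) (k : ℕ) (s : State) : Prop :=
  k + 1 < I.n ^ I.tableSize ∧ Searching I (k + 1) s ∨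
    k + 1 = I.n ^ I.tableSize ∧ s.get answer = 0 ∧ s.get exhausted = 1

/-- In the computation of `k + 1`, the digits of `k` below the place `j` have been carried. -/
structure Carrying (I : GNSPM) (k j : ℕ) (s : State) : Prop where
  ready : Ready I s
  cell_certificate : s.cell certificate = fun i => if i < j then 0 else digit I.n k i
  get_answer : s.get answer = 0
  get_exhausted : s.get exhausted = 0
  get_place : s.get place = j
  le_tableSize : j ≤ I.tableSize
  pow_dvd : I.n ^ j ∣ k + 1

theorem Searching.carrying (h : Searching I k s) : Carrying I k 0 (s.set place 0) := by
  obtain ⟨ready, cell_certificate, get_answer, get_exhausted⟩ := h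
  constructor <;> simp [*]

namespace Carrying

theorem eval_tableSize (h : Carrying I k j s) : tableSize.eval s = I.tableSize := by
  simp [tableSize, GNSPM.tableSize, h.ready.get_n, h.ready.get_rowLength]

theorem eval_digit (h : Carrying I k j s) :
    (Expr.cell certificate place).eval s = digit I.n k j := by
  simp [h.cell_certificate, h.get_place]

theorem decides_carries (h : Carrying I k j s) :
    carries.Decides s (j < I.tableSize ∧ digit I.n k j + 1 = I.n) := by
  refine (Expr.Decides.lt.and fun _ => .eq).congr ?_
  rw [h.eval_tableSize, Expr.eval_add, h.eval_digit, Expr.eval_var, Expr.eval_var, h.get_place,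
    h.ready.get_n, Expr.eval_ofNat]

theorem carry (h : Carrying I k j s) (hj : j < I.tableSize) (hdigit : digit I.n k j + 1 = I.n) :
    Carrying I k (j + 1) ((s.setCell certificate j 0).set place (j + 1)) := by
  have hn : 0 < I.n := by omega
  obtain ⟨ready, cell_certificate, get_answer, get_exhausted, -, -, pow_dvd⟩ := h
  refine ⟨by simp [ready], funext fun i => ?_, by simp [get_answer], by simp [get_exhausted],
    by simp, hj, (pow_succ_dvd_succ_iff hn pow_dvd).2 hdigit⟩
  rcases lt_trichotomy i j with hi | rfl | hi
  · simp [cell_certificate, hi, hi.ne, Nat.lt_succ_of_lt hi]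
  · simp
  · simp [cell_certificate, hi.ne', hi.not_gt, Nat.not_le_of_gt hi]

theorem searching_succ (h : Carrying I k j s) (hj : j < I.tableSize)
    (hdigit : digit I.n k j + 1 ≠ I.n) :
    Searching I (k + 1) (s.setCell certificate j (digit I.n k j + 1)) := by
  have hn := GNSPM.n_pos_of_lt_tableSize hj
  obtain ⟨ready, cell_certificate, get_answer, get_exhausted, -, -, pow_dvd⟩ := h
  constructor
  · simp [ready]
  · simp [cell_certificate, digit_succ hn pow_dvd hdigit]
  · simp [get_answer]
  · simp [get_exhausted]

theorem succ_ne_pow (h : Carrying I k j s) (hj : j < I.tableSize)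
    (hdigit : digit I.n k j + 1 ≠ I.n) : k + 1 ≠ I.n ^ I.tableSize := fun hk =>
  hdigit <| (pow_succ_dvd_succ_iff (GNSPM.n_pos_of_lt_tableSize hj) h.pow_dvd).1 <|
    hk ▸ pow_dvd_pow I.n hj

theorem increment_wp (h : Carrying I k j s) (hk : k < I.n ^ I.tableSize)
    (hcarries : carries.eval s = 0) : increment.wp I.bound (AtNextTable I k) s := by
  have hnot : ¬(j < I.tableSize ∧ digit I.n k j + 1 = I.n) := fun hj => by
    simp [h.decides_carries.1 hj] at hcarries
  have two_le := GNSPM.two_le_bound (I := I)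
  simp only [increment, wp_ite, wp_setCell, wp_set, Expr.eval_lt, h.eval_tableSize, Expr.eval_var,
    h.get_place, Expr.eval_add, h.eval_digit, Expr.eval_ofNat]
  split_ifs with hj
  · have hn := GNSPM.n_pos_of_lt_tableSize hj
    have hdigit := digit_lt hn k j
    have hne : digit I.n k j + 1 ≠ I.n := fun heq => hnot ⟨hj, heq⟩
    have n_le : I.n ≤ I.bound := GNSPM.le_bound (by have := I.le_size; omega)
    simpa [AtNextTable] using ⟨by omega, .inl ⟨lt_of_le_of_ne hk (h.succ_ne_pow hj hne),
      h.searching_succ hj hne⟩⟩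
  · obtain rfl : j = I.tableSize := h.le_tableSize.antisymm (not_lt.1 hj)
    have pow_le := Nat.le_of_dvd k.succ_pos h.pow_dvd
    simpa [AtNextTable, h.get_answer] using ⟨by omega, .inr (by omega)⟩

theorem body_wp (h : Carrying I k j s) (hcarries : carries.eval s ≠ 0) :
    (Cmd.setCell certificate place 0 ;; place ≔ place + 1).wp I.bound (fun s' =>
      (∃ j', Carrying I k j' s') ∧ I.tableSize - s'.get place < I.tableSize - s.get place) s := by
  obtain ⟨hj, hdigit⟩ : j < I.tableSize ∧ digit I.n k j + 1 = I.n :=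
    by_contra fun hnot => hcarries (h.decides_carries.2 hnot)
  have hcarry := h.carry hj hdigit
  have : I.tableSize ≤ 2 * (I.n + 1) ^ 2 := by rw [GNSPM.tableSize]; nlinarith
  have hbound := GNSPM.two_mul_sq_le_bound (I := I)
  simp only [wp_seq, wp_setCell, wp_set, Expr.eval_add, Expr.eval_var, Expr.eval_ofNat,
    State.get_setCell, h.get_place]
  refine ⟨Nat.zero_le _, by omega, ⟨j + 1, hcarry⟩, ?_⟩
  rw [hcarry.get_place]
  omega

end Carrying

theorem advance_runs (h : Searching I k s) (hk : k < I.n ^ I.tableSize) :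
    Runs I.bound advance s (advance.cost * (I.tableSize + 1)) (AtNextTable I k) := by
  have loop_runs := Runs.loop (b := I.bound) (e := carries) (s := s.set place 0)
    (fun s => ∃ j, Carrying I k j s) (fun s => I.tableSize - s.get place)
    (fun s ⟨j, hs⟩ hcarries => .of_wp (hs.body_wp hcarries)) ⟨0, h.carrying⟩
  have rest_runs := loop_runs.seq (c₂ := increment) fun s' ⟨⟨j, hs'⟩, hcarries⟩ =>
    .of_wp (hs'.increment_wp hk hcarries)
  refine (Runs.of_wp_seq (wp_set.2 ⟨Nat.zero_le _, rest_runs⟩)).mono ?_ fun _ => id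
  simp only [advance, Cmd.cost, State.get_set, if_true, Nat.sub_zero]
  nlinarith

/-- The program that goes to the next table if the cost of the current one exceeds `d`, and accepts
otherwise. -/
def tryTable : Cmd := evaluate ;; .ite (.lt (.mem 1) total) advance (answer ≔ 1)

/-- The program that tries all tables until one is accepted. -/
def search : Cmd :=
  answer ≔ 0 ;; exhausted ≔ 0 ;; .loop (.eq (answer + exhausted) 0) tryTable

/-- The program that decides whether there is a nearly stable perfect matching. -/
def solve : Cmd :=
  matchingSize ;; answer ≔ 0 ;; .ite (.lt (2 * engaged) n) .skip search

/-- The search has found the answer, or else `j` tables remain to be tried. -/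
def SearchInv (I : GNSPM) (j : ℕ) (s : State) : Prop :=
  (s.get answer + s.get exhausted ≠ 0 ∧ s.Answers I.IsYes) ∨
    ∃ k < I.n ^ I.tableSize, j = I.n ^ I.tableSize - k ∧ Searching I k s ∧
      ∀ k' < k, ¬I.IsCertificate (I.digitTable k')

theorem searchInv_zero (h : Searching I 0 s) : SearchInv I (I.n ^ I.tableSize) s := by
  refine .inr ⟨0, ?_, rfl, h, fun _ hlt => absurd hlt (Nat.not_lt_zero _)⟩
  rcases I.n.eq_zero_or_pos with hn | hn
  · simp [GNSPM.tableSize, hn]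
  · exact pow_pos hn _

theorem searchInv_of_isCertificate (h : I.IsCertificate (I.digitTable k)) :
    SearchInv I 0 (s.set answer 1) := by
  have get_answer : (s.set answer 1).get answer = 1 := by simp
  exact .inl ⟨by simp, fun _ => get_answer, fun hno => absurd h.isYes hno⟩

theorem searchInv_of_atNextTable
    (hno : ∀ k' < k + 1, ¬I.IsCertificate (I.digitTable k')) (h : AtNextTable I k s) :
    ∃ j < I.n ^ I.tableSize - k, SearchInv I j s := by
  rcases h with ⟨hlt, searching⟩ | ⟨heq, get_answer, get_exhausted⟩
  · exact ⟨_, by omega, .inr ⟨k + 1, hlt, rfl, searching, hno⟩⟩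
  · refine ⟨0, by omega, .inl ⟨by omega, fun hyes => ?_, fun _ => get_answer⟩⟩
    obtain ⟨k', hk', hcert⟩ := GNSPM.exists_isCertificate_digitTable hyes
    exact absurd hcert (hno k' (heq ▸ hk'))

theorem tableSize_lt_tableTime : I.tableSize < tableTime I.n := by
  rw [GNSPM.tableSize, tableTime]
  nlinarith [Nat.zero_le (I.n ^ 2), Nat.zero_le (I.n ^ 3)]

theorem tryTable_runs (h : Searching I k s) (hk : k < I.n ^ I.tableSize)
    (hno : ∀ k' < k, ¬I.IsCertificate (I.digitTable k')) :
    Runs I.bound tryTable s (tryTable.cost * tableTime I.n)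
      fun s' => ∃ j < I.n ^ I.tableSize - k, SearchInv I j s' := by
  have ite_runs (s' : State)
      (hs' : Searching I k s' ∧ s'.get total = I.tableCost (I.digitTable k)) :
      Runs I.bound (.ite (.lt (.mem 1) total) advance (answer ≔ 1)) s'
        ((Expr.lt (.mem 1) total).cost + 1 + advance.cost * (I.tableSize + 1) + (answer ≔ 1).cost)
        fun s' => ∃ j < I.n ^ I.tableSize - k, SearchInv I j s' := by
    obtain ⟨searching, get_total⟩ := hs'
    have eval_ne_zero :
        (Expr.lt (.mem 1) total).eval s' ≠ 0 ↔ ¬I.IsCertificate (I.digitTable k) := by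
      rw [← GNSPM.tableCost_le_iff]
      simp [searching.ready.mem_one, get_total]
    refine .ite (fun hlt => ?_) fun hle => ?_
    · refine (advance_runs searching hk).mono le_rfl fun s'' =>
        searchInv_of_atNextTable fun k' hk' => ?_
      rcases Nat.lt_succ_iff_lt_or_eq.1 hk' with hk' | rfl
      exacts [hno k' hk', eval_ne_zero.1 hlt]
    · refine .of_wp (wp_set.2 ⟨one_le_two.trans GNSPM.two_le_bound, 0, by omega, ?_⟩)
      exact searchInv_of_isCertificate (not_not.1 fun hnot => eval_ne_zero.2 hnot hle)
  refine ((evaluate_runs h).seq ite_runs).mono ?_ fun _ => id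
  have := tableSize_lt_tableTime (I := I)
  simp only [tryTable, Cmd.cost]
  nlinarith

/-- The time for trying all tables, up to a constant factor. -/
def searchTime (m : ℕ) : ℕ := tableTime m * (m ^ (2 * m * (m + 1)) + 1)

theorem search_runs (h : Ready I s) (hcell : s.cell certificate = 0) :
    Runs I.bound search s (search.cost * searchTime I.n) fun s' => s'.Answers I.IsYes := by
  have searching : Searching I 0 ((s.set answer 0).set exhausted 0) := by
    constructor <;> simp [h, hcell]
  have loop_runs := Runs.loop_of_variant (b := I.bound) (e := .eq (answer + exhausted) 0)
    (c := tryTable) (T := tryTable.cost * tableTime I.n) (SearchInv I) ?body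
    (searchInv_zero searching)
  case body =>
    rintro j s' (⟨hne, -⟩ | ⟨k, hk, rfl, hs', hno⟩) heval
    · simp at heval
      omega
    · exact tryTable_runs hs' hk hno
  refine (Runs.of_wp_seq (wp_set.2 ⟨Nat.zero_le _, Runs.of_wp_seq
      (wp_set.2 ⟨Nat.zero_le _, loop_runs⟩)⟩)).mono ?_ ?_
  · have := tableSize_lt_tableTime (I := I)
    have one_le : 1 ≤ tableTime I.n * (I.n ^ I.tableSize + 1) := Nat.mul_pos (by omega) (by omega)
    have le_searchTime : I.n ^ I.tableSize + 1 ≤ tableTime I.n * (I.n ^ I.tableSize + 1) :=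
      Nat.le_mul_of_pos_left _ (by omega)
    change _ ≤ search.cost * (tableTime I.n * (I.n ^ I.tableSize + 1))
    simp only [search, Cmd.cost]
    nlinarith
  · rintro s' ⟨⟨j, ⟨-, h⟩ | ⟨k, -, -, hs', -⟩⟩, heval⟩
    · exact h
    · simp [hs'.get_answer, hs'.get_exhausted] at heval

theorem solve_runs :
    Runs I.bound solve (.init I.encode)
      (solve.cost * (I.size + if I.n ≤ I.nm then searchTime I.n else 0))
      fun s => s.Answers I.IsYes := by
  have ite_runs (s : State) (h : Ready I s ∧ s.cell certificate = 0 ∧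
      ∃ M, I.profile.IsStable M ∧ M.card = s.get engaged) :
      Runs I.bound (.ite (.lt (2 * engaged) n) .skip search) (s.set answer 0)
        ((Expr.lt (2 * engaged) n).cost + 1 + 1 +
          search.cost * if I.n ≤ I.nm then searchTime I.n else 0) fun s => s.Answers I.IsYes := by
    obtain ⟨ready, hcell, M, hM, hcard⟩ := h
    refine .ite (fun hlt => ?_) fun hge => ?_
    · have hlt : 2 * M.card < I.n := by simpa [ready.get_n, hcard] using hlt
      have get_answer : (s.set answer 0).get answer = 0 := by simp
      exact .skip ⟨fun hyes => absurd hyes (GNSPM.not_isYes_of_card_lt hM hlt),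
        fun _ => get_answer⟩
    · have hge : I.n ≤ 2 * M.card := by simpa [ready.get_n, hcard] using hge
      rw [if_pos (GNSPM.n_le_nm hM hge)]
      exact search_runs (by simpa using ready) (by simpa using hcell)
  refine (matchingSize_runs.seq fun s h => Runs.of_wp_seq
    (wp_set.2 ⟨Nat.zero_le _, ite_runs s h⟩)).mono ?_ fun _ => id
  have := I.le_size
  generalize (if I.n ≤ I.nm then searchTime I.n else 0) = T
  simp only [solve, Cmd.cost, add_mul]
  gcongr <;> first | omega | exact Nat.le_mul_of_pos_right _ (by omega)

end WordRAM

/-! ### Running times -/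

namespace WordRAM

theorem Runs.exists_exec {I : GNSPM} {c : Cmd} {T : ℕ} {Q : State → Prop}
    (h : Runs I.bound c (.init I.encode) T Q) :
    ∃ t ≤ T, ∃ s, Exec (I.maxWord (4 * c.width)) c (.init I.encode) t s ∧ Q s := by
  obtain ⟨t, ht, s, hexec, -, hQ⟩ := h GNSPM.two_le_bound init_bdd
  refine ⟨t, ht, s, ?_, hQ⟩
  rw [GNSPM.maxWord, pow_mul]
  exact hexec _ le_rfl

theorem searchTime_mono : Monotone searchTime := by
  intro m n h
  have pow_le : m ^ (2 * m * (m + 1)) ≤ n ^ (2 * n * (n + 1)) := by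
    rcases m.eq_zero_or_pos with rfl | hm
    · rcases n.eq_zero_or_pos with rfl | hn
      · rfl
      · simpa using Nat.one_le_pow _ _ hn
    · exact (Nat.pow_le_pow_left h _).trans (Nat.pow_le_pow_right (by omega) (by gcongr))
  rw [searchTime, searchTime, tableTime, tableTime]
  gcongr

theorem searchTime_le {m : ℕ} (hm : 3 ≤ m) : searchTime m ≤ 24 * m ^ (4 * m ^ 2) := by
  have one_le : 1 ≤ m ^ (2 * m * (m + 1)) := Nat.one_le_pow _ _ (by omega)
  calc searchTime m
      ≤ (2 * m) * (2 * m) * (3 * m) * (2 * m ^ (2 * m * (m + 1))) := by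
        rw [searchTime, tableTime]
        gcongr <;> omega
    _ = 24 * m ^ (2 * m * (m + 1) + 3) := by ring
    _ ≤ 24 * m ^ (4 * m ^ 2) := by
        gcongr
        · omega
        · nlinarith

/-- The factor of the running time of the solver that depends on the parameter only. -/
noncomputable def timeFactor (m : ℕ) : ℝ := (m : ℝ) ^ ((m : ℝ) ^ 2 * Real.log m)

theorem one_le_timeFactor (m : ℕ) : 1 ≤ timeFactor m := by
  rcases m.eq_zero_or_pos with rfl | hm
  · simp [timeFactor]
  · have one_le : (1 : ℝ) ≤ m := Nat.one_le_cast.2 hm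
    exact Real.one_le_rpow one_le (mul_nonneg (sq_nonneg _) (Real.log_nonneg one_le))

theorem searchTime_isBigO_timeFactor :
    (fun m => (searchTime m : ℝ)) =O[Filter.atTop] timeFactor := by
  have log_tendsto := Real.tendsto_log_atTop.comp (tendsto_natCast_atTop_atTop (R := ℝ))
  refine .of_bound 24 ?_
  filter_upwards [Filter.eventually_ge_atTop 3, log_tendsto.eventually_ge_atTop 4] with m hm hlog
  rw [Real.norm_natCast, Real.norm_of_nonneg (zero_le_one.trans (one_le_timeFactor m))]
  calc (searchTime m : ℝ)
      ≤ 24 * (m : ℝ) ^ (4 * m ^ 2) := mod_cast searchTime_le hm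
    _ = 24 * (m : ℝ) ^ ((m : ℝ) ^ 2 * 4) := by
        rw [← Real.rpow_natCast]
        push_cast
        ring_nf
    _ ≤ 24 * timeFactor m := by
        rw [timeFactor]
        gcongr
        · exact Nat.one_le_cast.2 (by omega)
        · exact hlog

theorem exists_searchTime_le : ∃ K : ℝ, ∀ m, searchTime m ≤ K * timeFactor m := by
  obtain ⟨K, hK⟩ := (Asymptotics.isBigO_nat_atTop_iff fun m hm =>
    absurd hm (zero_lt_one.trans_le (one_le_timeFactor m)).ne').1 searchTime_isBigO_timeFactor
  refine ⟨K, fun m => ?_⟩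
  simpa [Real.norm_of_nonneg (zero_le_one.trans (one_le_timeFactor m))] using hK m

theorem exists_solve_time_le : ∃ K : ℝ, ∀ I : GNSPM,
    (solve.cost * (I.size + if I.n ≤ I.nm then searchTime I.n else 0) : ℕ) ≤
      K * (timeFactor I.nm * (I.n : ℝ) ^ 2 + 1) := by
  obtain ⟨K, hK⟩ := exists_searchTime_le
  have hK_nonneg : 0 ≤ K := by simpa [timeFactor] using (Nat.cast_nonneg _).trans (hK 0)
  refine ⟨solve.cost * (4 + (K + 2)), fun I => ?_⟩
  have one_le := one_le_timeFactor I.nm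
  set E := timeFactor I.nm
  have size_le : (I.size : ℝ) ≤ 4 * (E * (I.n : ℝ) ^ 2 + 1) := by
    have : (I.size : ℝ) ≤ 2 * ((I.n : ℝ) + 1) ^ 2 := mod_cast I.size_le
    nlinarith [sq_nonneg ((I.n : ℝ) - 1), le_mul_of_one_le_left (sq_nonneg (I.n : ℝ)) one_le]
  have search_le : ((if I.n ≤ I.nm then searchTime I.n else 0 : ℕ) : ℝ) ≤
      (K + 2) * (E * (I.n : ℝ) ^ 2 + 1) := by
    split_ifs with hle
    · rcases I.n.eq_zero_or_pos with hn | hn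
      · simp [hn, searchTime, tableTime]
        linarith
      · have one_le_sq : (1 : ℝ) ≤ (I.n : ℝ) ^ 2 := mod_cast Nat.one_le_pow 2 _ hn
        calc (searchTime I.n : ℝ) ≤ searchTime I.nm := mod_cast searchTime_mono hle
          _ ≤ K * E := hK _
          _ ≤ (K + 2) * (E * (I.n : ℝ) ^ 2 + 1) := by
            gcongr
            · linarith
            · nlinarith
    · rw [Nat.cast_zero]
      positivity
  push_cast at search_le ⊢
  rw [mul_assoc, add_mul]
  gcongr

/-- A bound on the number of words of the kernel plus its distance bound. -/
def kernelBound (m : ℕ) : ℕ := 4 * ((m + 2) * (m + 2) * (m + 2))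

theorem computable_kernelBound : Computable kernelBound := by
  have add_two : Primrec fun m : ℕ => m + 2 := Primrec.nat_add.comp .id (.const 2)
  exact (Primrec.nat_mul.comp (.const 4)
    (Primrec.nat_mul.comp (Primrec.nat_mul.comp add_two add_two) add_two)).to_comp

theorem size_add_d_le_kernelBound {I J : GNSPM} (h : J.IsKernel I) :
    J.size + J.d ≤ kernelBound I.nm := by
  have n_le : J.n ≤ I.nm + 1 := by have := h.two_mul_n_le; omega
  calc J.size + J.d ≤ 2 * (J.n + 1) ^ 2 + 2 * J.n ^ 3 := add_le_add J.size_le h.d_le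
    _ ≤ 2 * (I.nm + 1 + 1) ^ 2 + 2 * (I.nm + 1) ^ 3 := by gcongr
    _ ≤ kernelBound I.nm := by rw [kernelBound]; ring_nf; omega

end WordRAM

theorem mainTheorem10 :
    -- Globally Nearly Stable Perfect Matching is solvable in `O(nm ^ (nm² log nm) * n²)` time
    (∃ (c : WordRAM.Cmd) (k : ℕ) (C : ℝ), ∀ I : GNSPM,
      ∃ (t : ℕ) (s : WordRAM.State),
        WordRAM.Exec (I.maxWord k) c (WordRAM.State.init I.encode) t s ∧
        s.Answers I.IsYes ∧
        (t : ℝ) ≤ C * ((I.nm : ℝ) ^ ((I.nm : ℝ) ^ 2 * Real.log I.nm) * (I.n : ℝ) ^ 2 + 1)) ∧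
    -- and has a kernel with at most `2 * nm` agents, computable in linear time
    (∃ (c : WordRAM.Cmd) (k : ℕ) (C : ℝ) (g : ℕ → ℕ), Computable g ∧ ∀ I : GNSPM,
      ∃ (t : ℕ) (s : WordRAM.State) (J : GNSPM),
        WordRAM.Exec (I.maxWord k) c (WordRAM.State.init I.encode) t s ∧
        s.Outputs J.encode ∧
        (J.IsYes ↔ I.IsYes) ∧
        2 * J.n ≤ max (2 * I.nm) 2 ∧
        J.size + J.d ≤ g I.nm ∧
        (t : ℝ) ≤ C * I.size) := by
  obtain ⟨K, time_le⟩ := WordRAM.exists_solve_time_le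
  refine ⟨⟨WordRAM.solve, 4 * WordRAM.solve.width, K, fun I => ?_⟩,
    ⟨WordRAM.kernelize, 4 * WordRAM.kernelize.width, WordRAM.kernelize.cost,
      WordRAM.kernelBound, WordRAM.computable_kernelBound, fun I => ?_⟩⟩
  · obtain ⟨t, ht, s, hexec, answers⟩ := WordRAM.solve_runs (I := I).exists_exec
    exact ⟨t, s, hexec, answers, (Nat.cast_le.2 ht).trans (time_le I)⟩
  · obtain ⟨t, ht, s, hexec, J, outputs, isKernel⟩ := WordRAM.kernelize_runs (I := I).exists_exec
    exact ⟨t, s, J, hexec, outputs, isKernel.isYes_iff, isKernel.two_mul_n_le,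
      WordRAM.size_add_d_le_kernelBound isKernel, mod_cast ht⟩
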